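/- Let $F$ be a field of characteristic $p$, where $p$ is a prime or $p=\infty$ (the latter meaning characteristic zero), and let $n\ge s\ge 1$ be integers. **Notation.** For $m\ge 0$ let $D_m(F)$ be the descent algebra of the symmetric group $\mathfrak S_m$ (permutations being composed from left to right): the subalgebra of $F\mathfrak S_m$ spanned by the elements $\Xi^q$, $q$ a composition of $m$, where $\Xi^q$ is the sum of the minimal-length representatives of the right cosets in $\mathfrak S_m$ of the Young subgroup $\mathfrak S_q$. A partition is $p$-regular if no part occurs $p$ or more times (every partition is $\infty$-regular). Two partitions $\lambda,\mu$ of $m$ are $p$-equivalent, $\lambda\sim_p\mu$, if the $p'$-parts of permutations of cycle types $\lambda$ and $\mu$ are conjugate in $\mathfrak S_m$ (for $p=\infty$ the $p'$-part of a permutation is the permutation itself). For a $p$-regular partition $\lambda$ of $m$ let $M_\lambda$ be the one-dimensional left $D_m(F)$-module on which each $\Xi^q$ acts as the scalar $\varphi^q(\lambda)\cdot 1_F$, where $\varphi^q(\lambda)$ is the number of right cosets of $\mathfrak S_q$ in $\mathfrak S_m$ fixed by a permutation of cycle type $\lambda$. The Ext quiver $Q_{m,p}$ of $D_m(F)$ has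 as vertices the $p$-regular partitions of $m$ and has $\dim_F\operatorname{Ext}^1_{D_m(F)}(M_\lambda,M_\mu)$ arrows from $\lambda$ to $\mu$. For a $p$-regular partition $\mu$ of $n-s$ let $\mu^{\#s}$ be the unique $p$-regular partition of $n$ that is $p$-equivalent to the partition obtained from $\mu$ by adding one part equal to $s$. **Theorem.** The Ext quiver $Q_{n-s,p}$ of $D_{n-s}(F)$ is a subquiver of the Ext quiver $Q_{n,p}$ of $D_n(F)$, via the identification of the vertex $\mu$ of $Q_{n-s,p}$ with the vertex $\mu^{\#s}$ of $Q_{n,p}$. That is, the map $\mu\mapsto\mu^{\#s}$ is well defined and injective on vertices, and it extends to a morphism of quivers $Q_{n-s,p}\to Q_{n,p}$ that is injective on arrows. -/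

import Mathlib

/-!
Descent algebras of the symmetric groups, their simple modules and their Ext quivers.

Conventions.  Permutations are multiplied from left to right: the group is `(Perm (Fin n))ᵐᵒᵖ`,
where `op σ * op τ = op (τ * σ) = op (τ ∘ σ)`.  Consequently a right coset of a Young subgroup for
the left-to-right product is a left coset `σ * Y = {σ ∘ h | h ∈ Y}` for the product of
`Perm (Fin n)`.  Modules are left modules.  The characteristic is a natural number `p`, with
`p = 0` for characteristic zero (often written `p = ∞` in modular representation theory).
-/

namespace Descent

open Equiv

variable {n : ℕ}

/-- The Young subgroup of a composition `q` of `n`: the permutations that preserve each of the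
consecutive intervals of sizes `q₁, q₂, …` (`q.index i` is the number of the interval that
contains `i`). -/

def youngSubgroup (q : Composition n) : Subgroup (Perm (Fin n)) where
  carrier := {h | ∀ i, q.index (h i) = q.index i}
  one_mem' := by simp
  mul_mem' := by
    intro a b ha hb i
    rw [Perm.mul_apply, ha, hb]
  inv_mem' := by
    intro a ha i
    have := ha (a⁻¹ i)
    simpa using this.symm

/-- The (Coxeter) length of a permutation: its number of inversions. -/
noncomputable def inversions (σ : Perm (Fin n)) : ℕ :=
  Nat.card {x : Fin n × Fin n // x.1 < x.2 ∧ σ x.2 < σ x.1}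

open Classical in
/-- The representatives of minimal length of the cosets `σ * youngSubgroup q`. -/
noncomputable def minCosetReps (q : Composition n) : Finset (Perm (Fin n)) :=
  {σ | ∀ h ∈ youngSubgroup q, inversions σ ≤ inversions (σ * h)}

theorem index_mono (q : Composition n) : Monotone q.index := by
  intro i j hij
  by_contra! h
  have h1 := q.sizeUpTo_index_le i
  have h2 := q.lt_sizeUpTo_index_succ j
  have h3 : q.sizeUpTo (q.index j).succ ≤ q.sizeUpTo (q.index i) :=
    q.monotone_sizeUpTo (by simpa using h)
  have : (i : ℕ) ≤ j := hij
  omega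

open Classical in
theorem inversions_eq (q : Composition n) (σ : Perm (Fin n)) :
    inversions σ =
      Nat.card {x : Fin n × Fin n // q.index x.1 < q.index x.2 ∧ σ x.2 < σ x.1} +
      Nat.card {x : Fin n × Fin n //
        (x.1 < x.2 ∧ q.index x.1 = q.index x.2) ∧ σ x.2 < σ x.1} := by
  unfold inversions
  simp only [Nat.card_eq_fintype_card, Fintype.card_subtype]
  rw [← Finset.card_union_of_disjoint]
  · congr 1
    ext x
    simp only [Finset.mem_filter, Finset.mem_univ, true_and, Finset.mem_union]
    constructor
    · rintro ⟨h1, h2⟩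
      rcases (index_mono q h1.le).lt_or_eq with h | h
      · exact Or.inl ⟨h, h2⟩
      · exact Or.inr ⟨⟨h1, h⟩, h2⟩
    · rintro (⟨h1, h2⟩ | ⟨⟨h1, -⟩, h2⟩)
      · exact ⟨(index_mono q).reflect_lt h1, h2⟩
      · exact ⟨h1, h2⟩
  · rw [Finset.disjoint_filter]
    rintro x - ⟨h1, -⟩ ⟨⟨-, h2⟩, -⟩
    exact h1.ne h2

theorem cross_eq (q : Composition n) (σ h : Perm (Fin n)) (hh : h ∈ youngSubgroup q) :
    Nat.card {x : Fin n × Fin n // q.index x.1 < q.index x.2 ∧ (σ * h) x.2 < (σ * h) x.1} =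
      Nat.card {x : Fin n × Fin n // q.index x.1 < q.index x.2 ∧ σ x.2 < σ x.1} := by
  refine Nat.card_congr ((h.prodCongr h).subtypeEquiv ?_)
  intro x
  have h1 := hh x.1
  have h2 := hh x.2
  simp [h1, h2]

theorem sort_comp_eq {α : Type*} [LinearOrder α] {f : Fin n → α} (hf : Monotone f)
    (τ : Perm (Fin n)) : (f ∘ τ) ∘ Tuple.sort (f ∘ τ) = f := by
  have h1 := Tuple.monotone_sort (f ∘ τ)
  have h2 : Monotone (f ∘ (1 : Perm (Fin n))) := by simpa using hf
  have := Tuple.unique_monotone (f := f) (σ := τ * Tuple.sort (f ∘ τ)) (τ := 1) h1 h2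
  simpa [Function.comp_assoc] using this

/-- The minimal coset representatives are the permutations increasing on each block of `q`. -/
theorem mem_minCosetReps {q : Composition n} {σ : Perm (Fin n)} :
    σ ∈ minCosetReps q ↔ ∀ i j, i < j → q.index i = q.index j → σ i < σ j := by
  simp only [minCosetReps, Finset.mem_filter, Finset.mem_univ, true_and]
  constructor
  · intro hmin i j hij hq
    set τ := Tuple.sort (q.index ∘ (σ⁻¹ : Perm (Fin n))) with hτ
    have hs : (q.index ∘ (σ⁻¹ : Perm (Fin n))) ∘ τ = q.index :=
      sort_comp_eq (index_mono q) σ⁻¹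
    have hinc := (Tuple.eq_sort_iff.1 hτ).2
    have hmem : σ⁻¹ * τ ∈ youngSubgroup q := fun i => congrFun hs i
    have := hmin _ hmem
    rw [inversions_eq q, inversions_eq q (σ * _), cross_eq q σ _ hmem] at this
    have h0 : Nat.card {x : Fin n × Fin n //
        (x.1 < x.2 ∧ q.index x.1 = q.index x.2) ∧
          (σ * (σ⁻¹ * τ)) x.2 < (σ * (σ⁻¹ * τ)) x.1} = 0 := by
      rw [Finite.card_eq_zero_iff, isEmpty_subtype]
      rintro x ⟨⟨h1, h2⟩, h3⟩
      have := hinc x.1 x.2 h1 (by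
        have a := congrFun hs x.1
        have b := congrFun hs x.2
        simp only [Function.comp_apply] at a b ⊢
        rw [a, b, h2])
      simp only [mul_inv_cancel_left] at h3
      exact absurd h3 this.not_gt
    rw [h0] at this
    have h0' : Nat.card {x : Fin n × Fin n //
        (x.1 < x.2 ∧ q.index x.1 = q.index x.2) ∧ σ x.2 < σ x.1} = 0 := by omega
    rw [Finite.card_eq_zero_iff, isEmpty_subtype] at h0'
    have := h0' (i, j)
    simp only [hij, hq, and_self, true_and, not_lt] at this
    exact lt_of_le_of_ne this (fun h => hij.ne (σ.injective h))
  · intro hinc h hh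
    rw [inversions_eq q, inversions_eq q (σ * h), cross_eq q σ _ hh]
    have h0 : Nat.card {x : Fin n × Fin n //
        (x.1 < x.2 ∧ q.index x.1 = q.index x.2) ∧ σ x.2 < σ x.1} = 0 := by
      rw [Finite.card_eq_zero_iff, isEmpty_subtype]
      rintro x ⟨⟨h1, h2⟩, h3⟩
      exact absurd h3 (hinc _ _ h1 h2).not_gt
    omega

/-- The level sets of a monotone word are the blocks of a composition. -/
theorem exists_composition {α : Type*} [LinearOrder α] {f : Fin n → α} (hf : Monotone f) :
    ∃ c : Composition n, ∀ i j, c.index i = c.index j ↔ f i = f j := by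
  classical
  let I := Finset.univ.image f
  let e : I ≃o Fin I.card := (I.orderIsoOfFin rfl).symm
  let h : Fin n → Fin I.card := fun i => e ⟨f i, Finset.mem_image_of_mem _ (Finset.mem_univ _)⟩
  have hmono : Monotone h := fun i j hij => e.monotone (hf hij)
  have hinj : ∀ i j, h i = h j ↔ f i = f j := by simp [h]
  have hsurj : Function.Surjective h := by
    intro k
    obtain ⟨⟨x, hx⟩, rfl⟩ := e.surjective k
    obtain ⟨i, -, rfl⟩ := Finset.mem_image.1 hx
    exact ⟨i, rfl⟩
  let b : Fin I.card → ℕ := fun k => (Finset.univ.filter fun i => h i = k).card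
  let c : Composition n :=
    { blocks := List.ofFn b
      blocks_pos := by
        intro i hi
        obtain ⟨k, rfl⟩ := (List.mem_ofFn' _ _).1 hi
        obtain ⟨i, hi⟩ := hsurj k
        exact Finset.card_pos.2 ⟨i, by simp [hi]⟩
      blocks_sum := by
        rw [List.sum_ofFn, ← Finset.card_eq_sum_card_fiberwise (fun _ _ => Finset.mem_univ _)]
        simp }
  have hsize : ∀ k, k ≤ I.card →
      c.sizeUpTo k = (Finset.univ.filter fun i => (h i : ℕ) < k).card := by
    intro k
    induction k with
    | zero => simp
    | succ k ih =>
      intro hk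
      have hk' : k < c.length := by simpa [c, Composition.length] using hk
      rw [c.sizeUpTo_succ hk', ih (by omega)]
      have : c.blocks[k] = (Finset.univ.filter fun i => (h i : ℕ) = k).card := by
        simp [c, b, Fin.ext_iff]
      rw [this, ← Finset.card_union_of_disjoint]
      · congr 1
        ext i
        simp
        omega
      · rw [Finset.disjoint_filter]
        intros
        omega
  refine ⟨c, fun i j => ?_⟩
  have hidx : ∀ i, ((c.index i : ℕ)) = h i := by
    intro i
    have h1 : c.sizeUpTo (h i) ≤ i := by
      rw [hsize _ (h i).2.le]
      calc _ ≤ (Finset.Iio i).card := by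
            apply Finset.card_le_card
            intro x hx
            simp only [Finset.mem_filter, Finset.mem_univ, true_and] at hx
            exact Finset.mem_Iio.2 (hmono.reflect_lt hx)
        _ = i := by simp
    have h2 : (i : ℕ) < c.sizeUpTo (h i + 1) := by
      rw [hsize _ (h i).2]
      calc (i : ℕ) < (Finset.Iic i).card := by simp
        _ ≤ _ := by
            apply Finset.card_le_card
            intro x hx
            simp only [Finset.mem_filter, Finset.mem_univ, true_and]
            exact Nat.lt_succ_of_le (hmono (Finset.mem_Iic.1 hx))
    have h3 := c.sizeUpTo_index_le i
    have h4 := c.lt_sizeUpTo_index_succ i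
    rcases lt_trichotomy (c.index i : ℕ) (h i) with hlt | heq | hgt
    · have := c.monotone_sizeUpTo (show (c.index i).succ.val ≤ h i by simpa using hlt)
      omega
    · exact heq
    · have := c.monotone_sizeUpTo (show (h i : ℕ) + 1 ≤ c.index i from hgt)
      omega
  rw [← hinj, Fin.ext_iff, Fin.ext_iff, hidx, hidx]

/-- The composition whose blocks are the level sets of a monotone word. -/
noncomputable def levelComposition {α : Type*} [LinearOrder α] {f : Fin n → α}
    (hf : Monotone f) : Composition n :=
  (exists_composition hf).choose

theorem levelComposition_index {α : Type*} [LinearOrder α] {f : Fin n → α}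
    (hf : Monotone f) (i j : Fin n) :
    (levelComposition hf).index i = (levelComposition hf).index j ↔ f i = f j :=
  (exists_composition hf).choose_spec i j

/-- The words `g` that are rearrangements of `q.index`, weakly increasing on the blocks of `r`.
They index the terms of the product of the basis elements attached to `r` and `q`. -/
abbrev Word (r q : Composition n) : Type :=
  {g : Fin n → Fin q.length //
    (∃ ρ : Perm (Fin n), g = q.index ∘ ρ) ∧ Monotone fun i => toLex (r.index i, g i)}

open Classical in
noncomputable instance (r q : Composition n) : Fintype (Word r q) :=
  inferInstance

/-- The common refinement of `r` by the level sets of `g`. -/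
noncomputable def Word.comp {r q : Composition n} (g : Word r q) : Composition n :=
  levelComposition g.2.2

theorem Word.comp_index {r q : Composition n} (g : Word r q) (i j : Fin n) :
    g.comp.index i = g.comp.index j ↔ r.index i = r.index j ∧ g.1 i = g.1 j := by
  rw [Word.comp, levelComposition_index]
  simp

section Ring

variable (F : Type*) [CommRing F]

/-- `Ξ^q`: the sum of the minimal coset representatives of the Young subgroup of `q`, in the group
algebra of the symmetric group (with the left-to-right product). -/
noncomputable def Xi (q : Composition n) : MonoidAlgebra F (Perm (Fin n))ᵐᵒᵖ :=
  ∑ σ ∈ minCosetReps q, MonoidAlgebra.of F (Perm (Fin n))ᵐᵒᵖ (MulOpposite.op σ)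

theorem monotone_of_mem {r q : Composition n} {σ : Perm (Fin n)} (hσ : σ ∈ minCosetReps r) :
    Monotone fun i => toLex (r.index i, (q.index ∘ σ) i) := by
  intro i j hij
  rcases hij.eq_or_lt with rfl | hij
  · exact le_rfl
  rw [Prod.Lex.toLex_le_toLex]
  rcases (index_mono r hij.le).lt_or_eq with h | h
  · exact Or.inl h
  · exact Or.inr ⟨h, index_mono q (mem_minCosetReps.1 hσ i j hij h).le⟩

theorem sort_eq {q : Composition n} {τ : Perm (Fin n)} (hτ : τ ∈ minCosetReps q) :
    Tuple.sort (q.index ∘ (τ⁻¹ : Perm (Fin n))) = τ := by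
  symm
  rw [Tuple.eq_sort_iff]
  have : (q.index ∘ (τ⁻¹ : Perm (Fin n))) ∘ τ = q.index := by ext; simp
  rw [this]
  refine ⟨index_mono q, fun i j hij h => ?_⟩
  exact mem_minCosetReps.1 hτ i j hij (by simpa using h)

theorem sort_mem {q : Composition n} (ρ : Perm (Fin n)) :
    Tuple.sort (q.index ∘ ρ) ∈ minCosetReps q := by
  rw [mem_minCosetReps]
  intro i j hij h
  refine (Tuple.eq_sort_iff.1 (rfl : Tuple.sort (q.index ∘ ρ) = _)).2 i j hij ?_
  have := sort_comp_eq (index_mono q) ρ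
  have a := congrFun this i
  have b := congrFun this j
  simp only [Function.comp_apply] at a b ⊢
  rw [a, b, h]

/-- Solomon's theorem: products of the `Ξ^q` are sums of such elements. -/
theorem Xi_mul (r q : Composition n) :
    Xi F r * Xi F q = ∑ g : Word r q, Xi F g.comp := by
  classical
  unfold Xi
  rw [Finset.sum_mul_sum, ← Finset.sum_product', Finset.sum_sigma']
  refine Finset.sum_bij'
    (fun x hx => (⟨⟨q.index ∘ x.1, ⟨x.1, rfl⟩,
      monotone_of_mem (Finset.mem_product.1 hx).1⟩, x.2 * x.1⟩ :
        (_ : Word r q) × Perm (Fin n)))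
    (fun y _ => ((Tuple.sort (y.1.1 ∘ (y.2⁻¹ : Perm (Fin n))))⁻¹ * y.2,
      Tuple.sort (y.1.1 ∘ (y.2⁻¹ : Perm (Fin n))))) ?_ ?_ ?_ ?_ ?_
  · rintro ⟨σ, τ⟩ hx
    obtain ⟨hσ, hτ⟩ := Finset.mem_product.1 hx
    refine Finset.mem_sigma.2 ⟨Finset.mem_univ _, ?_⟩
    rw [mem_minCosetReps] at hσ hτ
    refine mem_minCosetReps.2 ?_
    intro i j hij h
    rw [Word.comp_index] at h
    exact hτ _ _ (hσ i j hij h.1) h.2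
  · rintro ⟨⟨g, ⟨ρ, rfl⟩, hm⟩, π⟩ hy
    replace hy := (Finset.mem_sigma.1 hy).2
    simp only
    have e : (q.index ∘ ρ) ∘ (π⁻¹ : Perm (Fin n)) = q.index ∘ (ρ * π⁻¹ : Perm (Fin n)) := rfl
    rw [e]
    set τ := Tuple.sort (q.index ∘ (ρ * π⁻¹ : Perm (Fin n))) with hτd
    have hτ : τ ∈ minCosetReps q := sort_mem _
    have hs : (q.index ∘ (ρ * π⁻¹ : Perm (Fin n))) ∘ τ = q.index :=
      sort_comp_eq (index_mono q) _
    have hs' : ∀ i, q.index ((τ⁻¹ * π) i) = q.index (ρ i) := by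
      intro i
      have := congrFun hs ((τ⁻¹ * π) i)
      simpa using this.symm
    refine Finset.mem_product.2 ⟨?_, hτ⟩
    rw [mem_minCosetReps] at hy hτ ⊢
    intro i j hij h
    simp only
    have h1 := hm hij.le
    simp only [Prod.Lex.toLex_le_toLex, h, lt_irrefl, false_or, true_and,
      Function.comp_apply] at h1
    by_contra! hle
    have hne : (τ⁻¹ * π) j ≠ (τ⁻¹ * π) i := fun h => hij.ne' ((τ⁻¹ * π).injective h)
    have hlt := lt_of_le_of_ne hle hne
    have h2 := index_mono q hle
    rw [hs', hs'] at h2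
    have h3 := le_antisymm h1 h2
    have h4 := hτ _ _ hlt (by rw [hs', hs', h3])
    have h5 := hy i j hij ((Word.comp_index _ i j).2 ⟨h, h3⟩)
    simp at h4
    exact absurd h4 h5.not_gt
  · rintro ⟨σ, τ⟩ hx
    obtain ⟨hσ, hτ⟩ := Finset.mem_product.1 hx
    have e : (q.index ∘ σ) ∘ ((τ * σ)⁻¹ : Perm (Fin n)) = q.index ∘ (τ⁻¹ : Perm (Fin n)) := by
      ext; simp
    simp only [e, sort_eq hτ]
    simp
  · rintro ⟨⟨g, ⟨ρ, rfl⟩, hm⟩, π⟩ hy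
    have e : (q.index ∘ ρ) ∘ (π⁻¹ : Perm (Fin n)) = q.index ∘ (ρ * π⁻¹ : Perm (Fin n)) := rfl
    simp only
    have hs : (q.index ∘ (ρ * π⁻¹ : Perm (Fin n))) ∘
        (Tuple.sort (q.index ∘ (ρ * π⁻¹ : Perm (Fin n)))) = q.index :=
      sort_comp_eq (index_mono q) _
    refine Sigma.ext (Subtype.ext ?_) (heq_of_eq ?_)
    · simp only
      ext i
      have := congrFun hs (((Tuple.sort (q.index ∘ (ρ * π⁻¹ : Perm (Fin n))))⁻¹ * π) i)
      rw [e]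
      simpa using (congrArg Fin.val this).symm
    · simp
  · rintro ⟨σ, τ⟩ hx
    simp [← MulOpposite.op_mul]

theorem exists_Xi_one (n : ℕ) : ∃ c : Composition n,
    (∀ i j, c.index i = c.index j) ∧ Xi F c = 1 := by
  have hm : Monotone (fun _ : Fin n => (0 : ℕ)) := monotone_const
  refine ⟨levelComposition hm, fun i j => (levelComposition_index hm i j).2 rfl, ?_⟩
  have : minCosetReps (levelComposition hm) = {1} := by
    ext σ
    rw [mem_minCosetReps, Finset.mem_singleton]
    constructor
    · intro h
      have hs : StrictMono σ := fun i j hij => h i j hij (by rw [levelComposition_index])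
      have h1 := (Equiv.Perm.monotone_iff σ).1 hs.monotone
      exact h1
    · rintro rfl i j hij -
      exact hij
  rw [Xi, this, Finset.sum_singleton]
  exact map_one _

/-- The descent algebra `D_n(F)`: the linear span of the elements `Ξ^q`, for `q` a composition of
`n`, which is a subalgebra of the group algebra. -/
noncomputable def descentAlgebra (n : ℕ) : Subalgebra F (MonoidAlgebra F (Perm (Fin n))ᵐᵒᵖ) :=
  (Submodule.span F (Set.range (Xi F : Composition n → _))).toSubalgebra
    (by
      obtain ⟨c, -, hc⟩ := exists_Xi_one F n
      exact hc ▸ Submodule.subset_span ⟨c, rfl⟩)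
    (by
      intro a b ha hb
      have h := Submodule.mul_mem_mul ha hb
      rw [Submodule.span_mul_span] at h
      refine Submodule.span_le.2 ?_ h
      rintro _ ⟨_, ⟨r, rfl⟩, _, ⟨q, rfl⟩, rfl⟩
      simp only [Xi_mul]
      exact Submodule.sum_mem _ fun g _ => Submodule.subset_span ⟨_, rfl⟩)


theorem index_surjective (c : Composition n) : Function.Surjective c.index := fun k =>
  ⟨c.embedding k ⟨0, c.one_le_blocksFun k⟩, c.index_embedding _ _⟩

theorem blocksFun_eq_card (c : Composition n) (k : Fin c.length) :
    c.blocksFun k = Nat.card {i // c.index i = k} := by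
  have : {i | c.index i = k} = Set.range (c.embedding k) := by
    ext i
    rw [c.mem_range_embedding_iff']
    exact eq_comm
  change _ = Nat.card ({i | c.index i = k} : Set (Fin n))
  rw [this, Nat.card_range_of_injective (c.embedding k).injective, Nat.card_fin]

theorem composition_ext {c c' : Composition n}
    (h : ∀ i j, c.index i = c.index j ↔ c'.index i = c'.index j) : c = c' := by
  have hle : ∀ i j, c.index i ≤ c.index j ↔ c'.index i ≤ c'.index j := by
    intro i j
    rcases le_total i j with hij | hij
    · simp [index_mono c hij, index_mono c' hij]
    · constructor <;> intro h1
      · exact ((h i j).1 (le_antisymm h1 (index_mono c hij))).le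
      · exact ((h i j).2 (le_antisymm h1 (index_mono c' hij))).le
  choose s hs using index_surjective c
  choose s' hs' using index_surjective c'
  let e : Fin c.length ≃o Fin c'.length :=
    { toFun := fun k => c'.index (s k)
      invFun := fun k => c.index (s' k)
      left_inv := fun k => by
        have : c.index (s' (c'.index (s k))) = c.index (s k) := (h _ _).2 (hs' _)
        exact this.trans (hs k)
      right_inv := fun k => by
        have : c'.index (s (c.index (s' k))) = c'.index (s' k) := (h _ _).1 (hs _)
        exact this.trans (hs' k)
      map_rel_iff' := by
        intro a b
        simp only [Equiv.coe_fn_mk]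
        rw [← hle, hs, hs] }
  have hlen : c.length = c'.length := by simpa using Fintype.card_congr e.toEquiv
  have he : ∀ k, (e k : ℕ) = k := fun k => by simp
  have hb : ∀ k, c.blocksFun k = c'.blocksFun (e k) := by
    intro k
    rw [blocksFun_eq_card, blocksFun_eq_card]
    refine Nat.card_congr (Equiv.subtypeEquivRight fun i => ?_)
    change _ ↔ c'.index i = c'.index (s k)
    rw [← h, hs]
  ext1
  refine List.ext_getElem hlen fun k h1 h2 => ?_
  have := hb ⟨k, h1⟩
  have h3 : e ⟨k, h1⟩ = ⟨k, h2⟩ := Fin.ext (he _)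
  rw [h3] at this
  simpa [Composition.blocksFun] using this

theorem apply_inv (τ : Perm (Fin n)) (i : Fin n) : τ (τ⁻¹ i) = i := by simp

/-- A permutation whose descents are exactly the block boundaries of `r`. -/
theorem exists_descents (r : Composition n) : ∃ w : Perm (Fin n), ∀ i j, i < j →
    (w i < w j ↔ r.index i = r.index j) := by
  set f : Fin n → (Fin r.length)ᵒᵈ := fun i => OrderDual.toDual (r.index i) with hf
  obtain ⟨h1, h2⟩ := Tuple.eq_sort_iff.1 (rfl : Tuple.sort f = _)
  set τ := Tuple.sort f
  refine ⟨τ⁻¹, fun i j hij => ⟨fun h => ?_, fun h => ?_⟩⟩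
  · have := h1 h.le
    simp only [Function.comp_apply, apply_inv] at this
    exact le_antisymm (index_mono r hij.le) this
  · by_contra! hle
    have hlt := lt_of_le_of_ne hle (fun h => hij.ne' ((τ⁻¹).injective h))
    have := h2 _ _ hlt (by simp [hf, h])
    simp only [apply_inv] at this
    exact absurd this hij.not_gt

theorem Xi_apply (q : Composition n) (σ : Perm (Fin n)) [Decidable (σ ∈ minCosetReps q)] :
    (Xi F q).coeff (MulOpposite.op σ) = if σ ∈ minCosetReps q then 1 else 0 := by
  classical
  simp [Xi, Finsupp.single_apply]

theorem linearIndependent_Xi : LinearIndependent F (Xi F : Composition n → _) := by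
  classical
  rw [Fintype.linearIndependent_iff]
  intro a ha
  by_contra! hne
  let K : Composition n → ℕ := fun q =>
    (Finset.univ.filter fun x : Fin n × Fin n => q.index x.1 = q.index x.2).card
  obtain ⟨r, hr, hmin⟩ := Finset.exists_min_image
    (Finset.univ.filter fun q => a q ≠ 0) K (by
      obtain ⟨q, hq⟩ := hne
      exact ⟨q, by simp [hq]⟩)
  obtain ⟨w, hw⟩ := exists_descents r
  have h1 := congrArg (fun x => x.coeff (MulOpposite.op w)) ha
  simp only [MonoidAlgebra.coeff_sum, MonoidAlgebra.coeff_smul, Finsupp.finsetSum_apply,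
    Finsupp.smul_apply, Xi_apply, MonoidAlgebra.coeff_zero, Finsupp.coe_zero, Pi.zero_apply,
    smul_eq_mul, mul_ite, mul_one, mul_zero] at h1
  rw [Finset.sum_eq_single r] at h1
  · rw [if_pos] at h1
    · exact (Finset.mem_filter.1 hr).2 h1
    · exact mem_minCosetReps.2 fun i j hij h => (hw i j hij).2 h
  · intro q _ hqr
    split_ifs with hq
    · by_contra haq
      have hK := hmin q (by simp [haq])
      rw [mem_minCosetReps] at hq
      have hlt : ∀ i j, i < j → q.index i = q.index j → r.index i = r.index j :=
        fun i j hij h => (hw i j hij).1 (hq i j hij h)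
      have himp : ∀ i j, q.index i = q.index j → r.index i = r.index j := by
        intro i j h
        rcases lt_trichotomy i j with h' | rfl | h'
        · exact hlt i j h' h
        · rfl
        · exact (hlt j i h' h.symm).symm
      have hsub : (Finset.univ.filter fun x : Fin n × Fin n => q.index x.1 = q.index x.2) ⊆
          (Finset.univ.filter fun x : Fin n × Fin n => r.index x.1 = r.index x.2) := by
        intro x hx
        simp only [Finset.mem_filter, Finset.mem_univ, true_and] at hx ⊢
        exact himp _ _ hx
      have heq := Finset.eq_of_subset_of_card_le hsub hK
      refine hqr (composition_ext fun i j => ⟨himp i j, fun h => ?_⟩)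
      have : (i, j) ∈ (Finset.univ.filter fun x : Fin n × Fin n =>
          r.index x.1 = r.index x.2) := by simp [h]
      rw [← heq] at this
      simpa using this
    · rfl
  · simp

end Ring

/-- The number of cosets of the Young subgroup of `q` fixed by `π`. -/
noncomputable def fixedCosets (q : Composition n) (π : Perm (Fin n)) : ℕ :=
  Nat.card (MulAction.fixedBy (Perm (Fin n) ⧸ youngSubgroup q) π)

/-- rearrangements of a word fixed by π -/
abbrev FixedWord {α : Type*} (f : Fin n → α) (π : Perm (Fin n)) : Type _ :=
  {w : Fin n → α // (∃ ρ : Perm (Fin n), w = f ∘ ρ) ∧ w ∘ π = w}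

theorem fixedCosets_eq (q : Composition n) (π : Perm (Fin n)) :
    fixedCosets q π = Nat.card (FixedWord q.index π) := by
  have key : ∀ σ τ : Perm (Fin n), ((σ : Perm (Fin n) ⧸ youngSubgroup q) = τ) ↔
      q.index ∘ (σ⁻¹ : Perm (Fin n)) = q.index ∘ (τ⁻¹ : Perm (Fin n)) := by
    intro σ τ
    rw [QuotientGroup.eq]
    constructor
    · intro h
      ext i
      have := h (τ⁻¹ i)
      simp at this
      simp [this]
    · intro h i
      have := congrFun h (τ i)
      simpa using this
  have fix : ∀ σ : Perm (Fin n), (π • (σ : Perm (Fin n) ⧸ youngSubgroup q) = σ) ↔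
      (q.index ∘ (σ⁻¹ : Perm (Fin n))) ∘ π = q.index ∘ (σ⁻¹ : Perm (Fin n)) := by
    intro σ
    rw [eq_comm]
    change ((σ : Perm (Fin n) ⧸ youngSubgroup q) = ((π * σ : Perm (Fin n)) : _ ⧸ _)) ↔ _
    rw [key]
    constructor
    · intro h
      ext i
      have := congrFun h (π i)
      simpa using congrArg Fin.val this
    · intro h
      ext i
      have := congrFun h (π⁻¹ i)
      simpa using congrArg Fin.val this
  unfold fixedCosets
  symm
  refine Nat.card_eq_of_bijective (fun w => (⟨((w.2.1.choose)⁻¹ : Perm (Fin n)), ?_⟩ :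
    MulAction.fixedBy (Perm (Fin n) ⧸ youngSubgroup q) π)) ⟨?_, ?_⟩
  · change π • (((w.2.1.choose)⁻¹ : Perm (Fin n)) : Perm (Fin n) ⧸ youngSubgroup q) = _
    rw [fix]
    simp only [inv_inv]
    rw [← w.2.1.choose_spec, w.2.2]
  · intro w w' h
    have h := congrArg Subtype.val h
    simp only at h
    rw [key] at h
    simp only [inv_inv] at h
    rw [← w.2.1.choose_spec, ← w'.2.1.choose_spec] at h
    exact Subtype.ext h
  · rintro ⟨x, hx⟩
    obtain ⟨σ, rfl⟩ := QuotientGroup.mk_surjective x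
    have hx' := (fix σ).1 hx
    refine ⟨⟨q.index ∘ (σ⁻¹ : Perm (Fin n)), ⟨_, rfl⟩, hx'⟩, Subtype.ext ?_⟩
    simp only
    rw [key]
    generalize_proofs h
    rw [inv_inv, ← h.choose_spec]

theorem card_fixedWord_congr {α β : Type*} {f : Fin n → α} {g : Fin n → β}
    (h : ∀ i j, f i = f j ↔ g i = g j) (π : Perm (Fin n)) :
    Nat.card (FixedWord f π) = Nat.card (FixedWord g π) := by
  refine Nat.card_eq_of_bijective
    (fun w => (⟨g ∘ w.2.1.choose, ⟨_, rfl⟩, ?_⟩ : FixedWord g π)) ⟨?_, ?_⟩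
  · ext i
    have h1 := congrFun w.2.2 i
    have h2 : ∀ i, w.1 i = f (w.2.1.choose i) := congrFun w.2.1.choose_spec
    simp only [Function.comp_apply, h2] at h1 ⊢
    exact (h _ _).1 h1
  · intro w w' hw
    have hw := congrArg Subtype.val hw
    refine Subtype.ext ?_
    rw [w.2.1.choose_spec, w'.2.1.choose_spec]
    ext i
    exact (h _ _).2 (congrFun hw i)
  · rintro ⟨_, ⟨ρ, rfl⟩, hfix⟩
    refine ⟨⟨f ∘ ρ, ⟨ρ, rfl⟩, ?_⟩, Subtype.ext ?_⟩
    · ext i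
      exact (h _ _).2 (congrFun hfix i)
    · simp only
      generalize_proofs h'
      ext i
      exact (h _ _).1 (congrFun h'.choose_spec i).symm

theorem fixedCosets_mul (r q : Composition n) (π : Perm (Fin n)) :
    fixedCosets r π * fixedCosets q π = ∑ g : Word r q, fixedCosets g.comp π := by
  have h1 : ∀ g : Word r q, fixedCosets g.comp π =
      Nat.card (FixedWord (fun i => toLex (r.index i, g.1 i)) π) := by
    intro g
    rw [fixedCosets_eq]
    refine card_fixedWord_congr (fun i j => ?_) π
    rw [Word.comp_index]
    simp
  simp only [h1]
  rw [← Nat.card_sigma, fixedCosets_eq, fixedCosets_eq, ← Nat.card_prod]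
  symm
  refine Nat.card_eq_of_bijective (fun x : (g : Word r q) × FixedWord _ π =>
    ((⟨fun i => (ofLex (x.2.1 i)).1, ?_, ?_⟩, ⟨fun i => (ofLex (x.2.1 i)).2, ?_, ?_⟩) :
      FixedWord r.index π × FixedWord q.index π)) ⟨?_, ?_⟩
  · obtain ⟨g, w, ⟨ρ, rfl⟩, hw⟩ := x
    exact ⟨ρ, rfl⟩
  · obtain ⟨g, w, hρ, hw⟩ := x
    ext i
    simpa using congrArg (fun a => ((ofLex a).1 : ℕ)) (congrFun hw i)
  · obtain ⟨⟨g, ⟨ρ', rfl⟩, hg⟩, w, ⟨ρ, rfl⟩, hw⟩ := x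
    exact ⟨ρ' * ρ, rfl⟩
  · obtain ⟨g, w, hρ, hw⟩ := x
    ext i
    simpa using congrArg (fun a => ((ofLex a).2 : ℕ)) (congrFun hw i)
  · rintro ⟨g, w, hρ, hw⟩ ⟨g', w', hρ', hw'⟩ h
    have e : w = w' := by
      ext i : 1
      have e1 := congrFun (congrArg (fun x => x.1.1) h) i
      have e2 := congrFun (congrArg (fun x => x.2.1) h) i
      exact ofLex.injective (Prod.ext e1 e2)
    subst e
    obtain ⟨ρ, rfl⟩ := hρ
    obtain ⟨ρ', h'⟩ := hρ'
    have a := sort_comp_eq g.2.2 ρ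
    have b := sort_comp_eq g'.2.2 ρ'
    rw [← h'] at b
    have eg : g = g' := by
      refine Subtype.ext ?_
      ext i : 1
      have := congrFun (a.symm.trans b) i
      exact congrArg (fun a => (ofLex a).2) this
    subst eg
    rfl
  · rintro ⟨⟨_, ⟨ρ, rfl⟩, hu⟩, ⟨_, ⟨ρ', rfl⟩, hv⟩⟩
    set w : Fin n → Fin r.length ×ₗ Fin q.length :=
      fun i => toLex (r.index (ρ i), q.index (ρ' i)) with hw
    set s := Tuple.sort w with hs
    have hm : Monotone (w ∘ s) := Tuple.monotone_sort w
    have hr : (r.index ∘ ρ) ∘ s = r.index := by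
      have m1 : Monotone (r.index ∘ (ρ * s : Perm (Fin n))) := by
        intro i j hij
        rcases Prod.Lex.toLex_le_toLex.1 (hm hij) with h | h
        · exact h.le
        · exact h.1.le
      have m2 : Monotone (r.index ∘ (1 : Perm (Fin n))) := by simpa using index_mono r
      have := Tuple.unique_monotone m1 m2
      simpa [Function.comp_assoc] using this
    have hr' : ∀ i, r.index (ρ (s i)) = r.index i := congrFun hr
    refine ⟨⟨⟨q.index ∘ (ρ' * s : Perm (Fin n)), ⟨_, rfl⟩, ?_⟩, ⟨w, ⟨s⁻¹, ?_⟩, ?_⟩⟩, ?_⟩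
    · intro i j hij
      have := hm hij
      simp only [hw, Function.comp_apply, hr'] at this
      exact this
    · ext i : 1
      have := hr' (s⁻¹ i)
      simp only [apply_inv] at this
      simp [hw, this]
    · ext i : 1
      have a := congrFun hu i
      have b := congrFun hv i
      simp only [Function.comp_apply] at a b
      simp [hw, a, b]
    · rfl


theorem exists_perm_parts (μ : n.Partition) :
    ∃ π : Perm (Fin n), π.partition.parts = μ.parts := by
  classical
  have hsplit := Multiset.filter_add_not (fun k => 2 ≤ k) μ.parts
  have hone : μ.parts.filter (fun k => ¬ 2 ≤ k) =
      Multiset.replicate (μ.parts.filter (fun k => ¬ 2 ≤ k)).card 1 := by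
    refine Multiset.eq_replicate_card.2 fun k hk => ?_
    have h1 := μ.parts_pos (Multiset.mem_of_mem_filter hk)
    have h2 := Multiset.of_mem_filter hk
    omega
  have hsum : (μ.parts.filter (fun k => 2 ≤ k)).sum +
      (μ.parts.filter (fun k => ¬ 2 ≤ k)).card = n := by
    have := congrArg Multiset.sum hsplit
    rw [Multiset.sum_add, hone, μ.parts_sum] at this
    simpa using this
  obtain ⟨g, hg⟩ := (Perm.exists_with_cycleType_iff (Fin n)
    (m := μ.parts.filter (fun k => 2 ≤ k))).2
    ⟨by rw [Fintype.card_fin]; omega, fun a ha => Multiset.of_mem_filter ha⟩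
  refine ⟨g, ?_⟩
  rw [Perm.parts_partition, ← Perm.sum_cycleType, hg, Fintype.card_fin]
  conv_rhs => rw [← hsplit, hone]
  congr 2
  omega

/-- A permutation of cycle type `μ` (fixed points counted as parts equal to `1`). -/
noncomputable def permOfPartition (μ : n.Partition) : Perm (Fin n) :=
  (exists_perm_parts μ).choose

/-- The value `φ^q(μ)` of the Young permutation character: the number of cosets of the Young
subgroup of `q` that are fixed by a permutation of cycle type `μ`. -/
noncomputable def youngCharacter (q : Composition n) (μ : n.Partition) : ℕ :=
  Nat.card (MulAction.fixedBy (Perm (Fin n) ⧸ youngSubgroup q) (permOfPartition μ))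

universe u

variable (F : Type u) [Field F]

/-- `Ξ^q` as an element of the descent algebra. -/
noncomputable def xi (q : Composition n) : descentAlgebra F n :=
  ⟨Xi F q, Submodule.subset_span ⟨q, rfl⟩⟩

/-- The elements `Ξ^q` form a basis of the descent algebra. -/
noncomputable def xiBasis (n : ℕ) : Module.Basis (Composition n) F (descentAlgebra F n) :=
  Module.Basis.span (linearIndependent_Xi F)

theorem xiBasis_apply (q : Composition n) : xiBasis F n q = xi F q :=
  Subtype.ext (congrArg Subtype.val (Module.Basis.span_apply (linearIndependent_Xi F) q))

theorem xi_mul (r q : Composition n) : xi F r * xi F q = ∑ g : Word r q, xi F g.comp := by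
  ext1
  simp [xi, Xi_mul]

/-- The algebra homomorphism `D_n(F) → F` with `Ξ^q ↦ φ^q(μ)`. -/
noncomputable def simpleCharacter (μ : n.Partition) : descentAlgebra F n →ₐ[F] F :=
  AlgHom.ofLinearMap ((xiBasis F n).constr F fun q => (youngCharacter q μ : F))
    (by
      obtain ⟨c, hc, h1⟩ := exists_Xi_one F n
      have : (1 : descentAlgebra F n) = xiBasis F n c := by
        rw [xiBasis_apply]; exact Subtype.ext h1.symm
      rw [this, Module.Basis.constr_basis]
      have : youngCharacter c μ = 1 := by
        have h2 : fixedCosets c (permOfPartition μ) = 1 := by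
          rw [fixedCosets_eq, Nat.card_eq_one_iff_unique]
          refine ⟨⟨?_⟩, ⟨⟨c.index, ⟨1, rfl⟩, funext fun i => hc _ _⟩⟩⟩
          rintro ⟨_, ⟨ρ, rfl⟩, -⟩ ⟨_, ⟨ρ', rfl⟩, -⟩
          exact Subtype.ext (funext fun i => hc _ _)
        exact h2
      simp [this])
    (by
      have h : (LinearMap.mul F (descentAlgebra F n)).compr₂
            ((xiBasis F n).constr F fun q => (youngCharacter q μ : F)) =
          (LinearMap.mul F F).compl₁₂
            ((xiBasis F n).constr F fun q => (youngCharacter q μ : F))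
            ((xiBasis F n).constr F fun q => (youngCharacter q μ : F)) := by
        refine (xiBasis F n).ext fun r => (xiBasis F n).ext fun q => ?_
        simp only [LinearMap.compr₂_apply, LinearMap.mul_apply', LinearMap.compl₁₂_apply,
          Module.Basis.constr_basis]
        rw [xiBasis_apply, xiBasis_apply, xi_mul, map_sum]
        simp only [← xiBasis_apply, Module.Basis.constr_basis]
        have := fixedCosets_mul r q (permOfPartition μ)
        simp only [fixedCosets] at this
        simp only [youngCharacter]
        rw [← Nat.cast_mul, ← Nat.cast_sum, this]
      intro x y
      exact LinearMap.congr_fun (LinearMap.congr_fun h x) y)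

theorem simpleCharacter_xi (q : Composition n) (μ : n.Partition) :
    simpleCharacter F μ (xi F q) = youngCharacter q μ := by
  rw [← xiBasis_apply]
  exact (xiBasis F n).constr_basis F (fun q => (youngCharacter q μ : F)) q


/-- The one-dimensional module `M_μ`: the space `F`, on which `Ξ^q` acts as the scalar `φ^q(μ)`. -/
def SimpleModule (_μ : n.Partition) : Type _ := F

noncomputable instance (μ : n.Partition) : AddCommGroup (SimpleModule F μ) :=
  inferInstanceAs (AddCommGroup F)

noncomputable instance (μ : n.Partition) : Module (descentAlgebra F n) (SimpleModule F μ) :=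
  Module.compHom F (simpleCharacter F μ).toRingHom

theorem smul_simpleModule (μ : n.Partition) (a : descentAlgebra F n) (v : SimpleModule F μ) :
    a • v = (HMul.hMul (α := F) (β := F) (simpleCharacter F μ a) v : F) := rfl

/-- `p`-regular partitions: no part occurs `p` or more times (no condition if `p = 0`). -/
def IsRegular (p : ℕ) (μ : n.Partition) : Prop :=
  p ≠ 0 → ∀ i, μ.parts.count i < p

/-- `h` is the `p'`-part of the element `g` of a finite group: `g = u * h` with `u` a commuting
`p`-element and `h` of order prime to `p`.  For `p = 0` this says `h = g`. -/
def IsPrimeToPart (p : ℕ) {G : Type*} [Group G] (g h : G) : Prop :=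
  ∃ u : G, g = u * h ∧ Commute u h ∧ (∃ k : ℕ, orderOf u = p ^ k) ∧ ¬ p ∣ orderOf h

/-- `p`-equivalence of partitions: the `p'`-parts of permutations of cycle types `μ` and `ν` are
conjugate. -/
def PEquivalent (p : ℕ) (μ ν : n.Partition) : Prop :=
  ∀ σ τ : Perm (Fin n), σ.partition.parts = μ.parts → τ.partition.parts = ν.parts →
    ∀ σ' τ' : Perm (Fin n), IsPrimeToPart p σ σ' → IsPrimeToPart p τ τ' → IsConj σ' τ'

/-- The partition `μ # (s)` of `n + s` obtained from `μ` by adding a part `s`. -/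
def addPart (μ : n.Partition) (s : ℕ) : (n + s).Partition :=
  Nat.Partition.ofSums (n + s) (s ::ₘ μ.parts) (by
    rw [Multiset.sum_cons, μ.parts_sum, add_comm])

/-- The number of arrows `lam ⟶ mu`, which is `dim_F Ext¹(M_lam, M_mu)`, the Ext group being taken
in the category of left `D_n(F)`-modules. -/
noncomputable def numArrows (lam mu : n.Partition) : ℕ :=
  Module.finrank F (CategoryTheory.Abelian.Ext
    (ModuleCat.of (descentAlgebra F n) (SimpleModule F lam))
    (ModuleCat.of (descentAlgebra F n) (SimpleModule F mu)) 1)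

/-- The vertices of the Ext quiver of `D_n(F)`, for `F` of characteristic `p`: the `p`-regular
partitions `lam` of `n`, which label the simple modules `M_lam`. -/
def ExtQuiver (_F : Type u) [Field _F] (p n : ℕ) : Type :=
  {lam : n.Partition // IsRegular p lam}

/-- The arrows of the Ext quiver: `dim_F Ext¹(M_lam, M_mu)` of them from `lam` to `mu`. -/
noncomputable instance (p n : ℕ) : Quiver (ExtQuiver F p n) where
  Hom lam mu := Fin (numArrows F lam.1 mu.1)

end Descent

/-! The theorem rests on a surjective algebra homomorphism D_{m+s}(F) → D_m(F), `descentRestrict`,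
along which the character of M_μ pulls back to that of M_{μ^{#s}}.

To construct it, the descent algebra is realized, following Bidigare, as the algebra of
symmetric-group invariants in the monoid algebra of the faces of the braid arrangement: `toFaces`
sends Ξ^q to the sum of the faces of type q. It is multiplicative because Solomon's product rule
counts the factorizations of a face (`Face.card_factorizations`). On faces the homomorphism is
natural: if the last s points lie in one class, restrict to the first m points; otherwise map to
zero. A product joins the last s points exactly when both factors do (`Face.joins_mul`), so this is
multiplicative; it commutes with permutations of the first m points, so it preserves invariants.
Surjectivity is a triangularity argument on the size of the lowest class.

For characters, φ^q(μ) is the number of faces of type q fixed by a permutation π of cycle type μ. A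
face is fixed by π together with an s-cycle on the new points exactly when it joins these points and
its restriction is fixed by π. Hence the character of μ pulls back to that of μ with a part s added
(`simpleCharacter_addPart`). A p-group acting on a finite set has, modulo p, as many fixed points as
there are points, so over F characters depend only on p-equivalence classes.

For arrows, Ext¹ of one-dimensional modules is the space of twisted derivations modulo inner ones.
If a derivation becomes inner after composition with a surjection, it was already inner, so
inflation is injective on Ext¹ (`finrank_ext_le`). For vertices, p-equivalence is equality of the
weights `primeToWeight`, and adding a part s changes these by an amount independent of μ. -/

namespace Descent

open Equiv

universe u

/-! ### Ext¹ between one-dimensional modules -/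

section TwistedDerivations

open CategoryTheory Abelian

variable {F A : Type u} [Field F] [Ring A] [Algebra F A]

/-- The linear maps `d : A → F` with `d (a * b) = ψ a * d b + d a * χ b`. -/
def twistedDerivations (χ ψ : A →ₐ[F] F) : Submodule F (A →ₗ[F] F) where
  carrier := {d | ∀ a b, d (a * b) = ψ a * d b + d a * χ b}
  add_mem' := by
    intro d e hd he a b
    simp only [LinearMap.add_apply, hd a b, he a b]
    ring
  zero_mem' := by simp
  smul_mem' := by
    intro c d hd a b
    simp only [LinearMap.smul_apply, hd a b, smul_eq_mul]
    ring

/-- The one-dimensional module on which `a : A` acts as the scalar `χ a`. -/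
def CharModule (_χ : A →ₐ[F] F) : Type u := F

noncomputable instance (χ : A →ₐ[F] F) : AddCommGroup (CharModule χ) :=
  inferInstanceAs (AddCommGroup F)

noncomputable instance (χ : A →ₐ[F] F) : Module A (CharModule χ) :=
  Module.compHom F χ.toRingHom

/-- The orbit map `a ↦ a • 1` onto a one-dimensional module. -/
def toCharModule (χ : A →ₐ[F] F) : A →ₗ[A] CharModule χ where
  toFun a := (χ a : F)
  map_add' := map_add χ
  map_smul' := map_mul χ

theorem toCharModule_surjective (χ : A →ₐ[F] F) : Function.Surjective (toCharModule χ) :=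
  fun c => ⟨algebraMap F _ c, χ.commutes c⟩

/-- The restriction of a twisted derivation to the kernel of the first character is a
homomorphism of modules. -/
def restrictKer {χ ψ : A →ₐ[F] F} (d : twistedDerivations χ ψ) :
    LinearMap.ker (toCharModule χ) →ₗ[A] CharModule ψ where
  toFun k := (d.1 k.1 : F)
  map_add' x y := map_add d.1 x.1 y.1
  map_smul' a k := by
    have h : χ k.1 = 0 := k.2
    have := d.2 a k.1
    rw [h, mul_zero, add_zero] at this
    exact this

/-- The class in `Ext¹` of the pushout of `0 → ker χ → A → F → 0` along the restriction of a
twisted derivation. -/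
noncomputable def toExt (χ ψ : A →ₐ[F] F) :
    twistedDerivations χ ψ →ₗ[F]
      Ext (ModuleCat.of A (CharModule χ)) (ModuleCat.of A (CharModule ψ)) 1 :=
  Ext.precompOfLinear
      (LinearMap.shortExact_shortComplexKer (toCharModule_surjective χ)).extClass F
      (ModuleCat.of A (CharModule ψ)) (add_zero 1) ∘ₗ
    (Ext.linearEquiv₀ (R := F)).symm.toLinearMap ∘ₗ
    { toFun := fun d => ModuleCat.ofHom (restrictKer d)
      map_add' := fun _ _ => rfl
      map_smul' := fun c d => by
        ext x
        change (c * d.1 x.1 : F) = (ψ (algebraMap F _ c) * d.1 x.1 : F)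
        rw [AlgHom.commutes]
        rfl }

theorem toExt_apply {χ ψ : A →ₐ[F] F} (d : twistedDerivations χ ψ) :
    toExt χ ψ d =
      (LinearMap.shortExact_shortComplexKer (toCharModule_surjective χ)).extClass.comp
        (Ext.mk₀ (ModuleCat.ofHom (restrictKer d))) (add_zero 1) := rfl

theorem sub_algebraMap_mem_ker (χ : A →ₐ[F] F) (a : A) :
    a - algebraMap F A (χ a) ∈ LinearMap.ker (toCharModule χ) := by
  change χ (a - algebraMap F _ (χ a)) = 0
  rw [map_sub, AlgHom.commutes]
  exact sub_self _

/-- Since A is projective, every class comes from a homomorphism f on ker χ. Composing f with the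
projection a ↦ a - χ(a) of A onto ker χ gives a twisted derivation that restricts to f. -/
theorem toExt_surjective (χ ψ : A →ₐ[F] F) : Function.Surjective (toExt χ ψ) := by
  intro x
  have hP : Projective (ModuleCat.of A A) :=
    ModuleCat.projective_of_free (Module.Basis.singleton Unit A)
  obtain ⟨y, hy⟩ := Ext.contravariant_sequence_exact₃
    (LinearMap.shortExact_shortComplexKer (toCharModule_surjective χ)) _ x
    (Ext.eq_zero_of_projective (P := ModuleCat.of A A) _) (add_zero 1)
  obtain ⟨f, rfl⟩ := (Ext.mk₀_bijective _ _).2 y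
  let g : LinearMap.ker (toCharModule χ) → F := fun k => f.hom k
  have gadd : ∀ x y, g (x + y) = g x + g y := map_add f.hom
  have gsmul : ∀ (a : A) x, g (a • x) = ψ a * g x := fun a x => map_smul f.hom a x
  let d : A →ₗ[F] F :=
    { toFun := fun a => g ⟨_, sub_algebraMap_mem_ker χ a⟩
      map_add' := fun a b => by
        rw [← gadd]
        congr 1
        ext1
        simp only [map_add, Submodule.coe_add]
        abel
      map_smul' := fun c a => by
        have := gsmul (algebraMap F _ c) ⟨_, sub_algebraMap_mem_ker χ a⟩
        rw [AlgHom.commutes] at this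
        refine Eq.trans ?_ this
        congr 1
        ext1
        simp [mul_sub, Algebra.smul_def] }
  have hd : d ∈ twistedDerivations χ ψ := by
    intro a b
    have h1 := gsmul a ⟨_, sub_algebraMap_mem_ker χ b⟩
    have h2 := gsmul (algebraMap F _ (χ b)) ⟨_, sub_algebraMap_mem_ker χ a⟩
    rw [AlgHom.commutes] at h2
    change g _ = _ * g _ + g _ * _
    rw [← h1, mul_comm (g _)]
    refine Eq.trans ?_ (congrArg₂ (· + ·) rfl h2)
    rw [← gadd]
    congr 1
    ext1
    simp only [map_mul, Submodule.coe_add, Submodule.coe_smul, smul_eq_mul, mul_sub]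
    rw [Algebra.commutes (χ b) a, Algebra.commutes (χ b) (algebraMap F _ (χ a))]
    abel
  refine ⟨⟨d, hd⟩, ?_⟩
  rw [toExt_apply, ← hy]
  congr 2
  ext k
  have hk : χ k.1 = 0 := k.2
  change g _ = g _
  congr 1
  ext1
  simp [hk]

/-- By the long exact sequence the class vanishes exactly when the restriction of d to ker χ extends
to a module map on A. Such a map is a ↦ c ψ(a), and its value at a - χ(a) is c(ψ(a) - χ(a)); this is
d(a) because d(1) = 0. -/
theorem toExt_eq_zero_iff {χ ψ : A →ₐ[F] F} (d : twistedDerivations χ ψ) :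
    toExt χ ψ d = 0 ↔ ∃ c : F, ∀ a, d.1 a = c * (ψ a - χ a) := by
  have h1 : d.1 1 = 0 := by
    have := d.2 1 1
    simpa using this
  rw [toExt_apply]
  constructor
  · intro h0
    obtain ⟨y, hy⟩ := Ext.contravariant_sequence_exact₁
      (LinearMap.shortExact_shortComplexKer (toCharModule_surjective χ)) _ _ _ h0
    obtain ⟨f, rfl⟩ := (Ext.mk₀_bijective _ _).2 y
    rw [Ext.mk₀_comp_mk₀] at hy
    have hf := (Ext.mk₀_bijective _ _).1 hy
    let g : A → F := fun a => f.hom a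
    have gsmul : ∀ a : A, g (a • (1 : A)) = ψ a * g 1 := fun a => map_smul f.hom a (1 : A)
    refine ⟨g 1, fun a => ?_⟩
    have e1 : g (a - algebraMap F A (χ a)) = d.1 (a - algebraMap F A (χ a)) := congrArg (fun t =>
      t.hom (⟨_, sub_algebraMap_mem_ker χ a⟩ : LinearMap.ker (toCharModule χ))) hf
    have e2 := gsmul (a - algebraMap F A (χ a))
    rw [smul_eq_mul, mul_one, e1, map_sub, map_sub, Algebra.algebraMap_eq_smul_one, map_smul,
      map_smul, h1, map_one] at e2
    simpa [mul_comm] using e2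
  · rintro ⟨c, hc⟩
    let f : A →ₗ[A] CharModule ψ := LinearMap.toSpanSingleton _ _ c
    have : ModuleCat.ofHom (restrictKer d) =
        (toCharModule χ).shortComplexKer.f ≫ ModuleCat.ofHom f := by
      ext k
      have hk : χ k.1 = 0 := k.2
      have := hc k.1
      rw [hk, sub_zero, mul_comm] at this
      exact this
    rw [this, ← Ext.mk₀_comp_mk₀, ← Ext.comp_assoc_of_second_deg_zero,
      ShortComplex.ShortExact.extClass_comp, Ext.zero_comp]

/-- Inflation along a surjective algebra homomorphism does not decrease the dimension of `Ext¹`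
between one-dimensional modules. -/
theorem finrank_ext_le {B : Type u} [Ring B] [Algebra F B] [FiniteDimensional F A]
    {Δ : A →ₐ[F] B} (hΔ : Function.Surjective Δ) (χ ψ : B →ₐ[F] F) :
    Module.finrank F (Ext (ModuleCat.of B (CharModule χ)) (ModuleCat.of B (CharModule ψ)) 1) ≤
      Module.finrank F (Ext (ModuleCat.of A (CharModule (χ.comp Δ)))
        (ModuleCat.of A (CharModule (ψ.comp Δ))) 1) := by
  let pull : twistedDerivations χ ψ →ₗ[F] twistedDerivations (χ.comp Δ) (ψ.comp Δ) :=
    { toFun := fun d => ⟨d.1 ∘ₗ Δ.toLinearMap, fun a b => by simpa using d.2 (Δ a) (Δ b)⟩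
      map_add' := fun _ _ => rfl
      map_smul' := fun _ _ => rfl }
  -- A linear section of `toExt` stands in for the inflation map: lift a class to a derivation,
  -- compose it with Δ, and take its class over A.
  obtain ⟨s, hs⟩ := (toExt χ ψ).exists_rightInverse_of_surjective
    (LinearMap.range_eq_top.2 (toExt_surjective χ ψ))
  -- Finiteness of the target matters: `Module.finrank` of an infinite-dimensional space is 0.
  have : FiniteDimensional F (Ext (ModuleCat.of A (CharModule (χ.comp Δ)))
      (ModuleCat.of A (CharModule (ψ.comp Δ))) 1) :=
    Module.Finite.of_surjective _ (toExt_surjective (χ.comp Δ) (ψ.comp Δ))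
  refine LinearMap.finrank_le_finrank_of_injective
    (f := toExt (χ.comp Δ) (ψ.comp Δ) ∘ₗ pull ∘ₗ s) ?_
  refine (injective_iff_map_eq_zero _).2 fun v hv => ?_
  obtain ⟨c, hc⟩ := (toExt_eq_zero_iff _).1 hv
  have : toExt χ ψ (s v) = v := LinearMap.congr_fun hs v
  rw [← this, toExt_eq_zero_iff]
  refine ⟨c, fun b => ?_⟩
  obtain ⟨a, rfl⟩ := hΔ b
  exact hc a

end TwistedDerivations

/-- A surjection of descent algebras under which simple characters pull back to simple characters
does not decrease the number of arrows. -/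
theorem numArrows_le {F : Type u} [Field F] {n m : ℕ}
    {Δ : descentAlgebra F n →ₐ[F] descentAlgebra F m}
    (hΔ : Function.Surjective Δ) {lam mu : m.Partition} {lam' mu' : n.Partition}
    (hlam : simpleCharacter F lam' = (simpleCharacter F lam).comp Δ)
    (hmu : simpleCharacter F mu' = (simpleCharacter F mu).comp Δ) :
    numArrows F lam mu ≤ numArrows F lam' mu' := by
  have : FiniteDimensional F (descentAlgebra F n) := Module.Finite.of_basis (xiBasis F n)
  have h := finrank_ext_le hΔ (simpleCharacter F lam) (simpleCharacter F mu)
  rw [← hlam, ← hmu] at h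
  exact h

/-! ### The monoid of faces and the types of faces -/

/-- Total preorders on `ι`, that is, faces of the braid arrangement. -/
@[ext]
structure Face (ι : Type*) where
  le : ι → ι → Prop
  total : ∀ i j, le i j ∨ le j i
  trans : ∀ i j k, le i j → le j k → le i k

namespace Face

variable {ι κ : Type*}

theorem refl (G : Face ι) (i : ι) : G.le i i := (G.total i i).elim id id

noncomputable instance [Finite ι] : Fintype (Face ι) :=
  @Fintype.ofFinite _ (Finite.of_injective Face.le fun _ _ => Face.ext)

/-- The Tits product: refine the first preorder by the second. -/
instance : Monoid (Face ι) where
  one := ⟨fun _ _ => True, by simp, by simp⟩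
  mul G H :=
    { le := fun i j => G.le i j ∧ (G.le j i → H.le i j)
      total := fun i j => by
        have := G.total i j
        have := H.total i j
        tauto
      trans := fun i j k hij hjk => by
        have := G.trans i j k hij.1 hjk.1
        refine ⟨this, fun hki => H.trans i j k (hij.2 ?_) (hjk.2 ?_)⟩
        · exact G.trans j k i hjk.1 hki
        · exact G.trans k i j hki hij.1 }
  mul_assoc G H K := by
    ext i j
    change ((_ ∧ (_ → _)) ∧ (_ ∧ (_ → _) → _)) ↔ (_ ∧ (_ → _ ∧ (_ → _)))
    tauto
  one_mul G := by
    ext i j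
    change (True ∧ (True → _)) ↔ _
    simp
  mul_one G := by
    ext i j
    change (_ ∧ (_ → True)) ↔ _
    simp

theorem mul_le {G H : Face ι} {i j : ι} : (G * H).le i j ↔ G.le i j ∧ (G.le j i → H.le i j) :=
  Iff.rfl

/-- The pullback of a total preorder along a map. -/
def comap (f : κ → ι) : Face ι →* Face κ where
  toFun G := ⟨fun i j => G.le (f i) (f j), fun _ _ => G.total _ _, fun _ _ _ => G.trans _ _ _⟩
  map_one' := rfl
  map_mul' _ _ := rfl

theorem comap_le (f : κ → ι) (G : Face ι) (i j : κ) : (comap f G).le i j ↔ G.le (f i) (f j) :=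
  Iff.rfl

/-- The action of a permutation on total preorders. -/
def perm (ρ : Perm ι) : Face ι ≃* Face ι where
  __ := comap ρ
  invFun := comap ρ.symm
  left_inv G := by ext i j; simp [comap]
  right_inv G := by ext i j; simp [comap]

theorem perm_le (ρ : Perm ι) (G : Face ι) (i j : ι) : (perm ρ G).le i j ↔ G.le (ρ i) (ρ j) :=
  Iff.rfl

/-- Pulling back is a right action of `Perm ι`. -/
theorem perm_perm (ρ σ : Perm ι) (G : Face ι) : perm σ (perm ρ G) = perm (ρ * σ) G := rfl

theorem perm_symm (ρ : Perm ι) : (perm ρ).symm = perm ρ⁻¹ := rfl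

/-- The pullback of a linear order along a map. -/
def of {α : Type*} [LinearOrder α] (f : ι → α) : Face ι :=
  ⟨fun i j => f i ≤ f j, fun _ _ => le_total _ _, fun _ _ _ => le_trans⟩

theorem of_le {α : Type*} [LinearOrder α] (f : ι → α) (i j : ι) : (of f).le i j ↔ f i ≤ f j :=
  Iff.rfl

open Classical in
/-- The number of elements strictly below `i`. -/
noncomputable def rank [Fintype ι] (G : Face ι) (i : ι) : ℕ :=
  (Finset.univ.filter fun j => ¬ G.le i j).card

/-- This lets a face be handled as a function to ℕ, which can be sorted and compared pointwise. -/
theorem rank_le_rank [Fintype ι] (G : Face ι) {i j : ι} : G.rank i ≤ G.rank j ↔ G.le i j := by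
  classical
  have mono : ∀ {i j}, G.le i j → G.rank i ≤ G.rank j := fun {i j} h =>
    Finset.card_le_card fun k hk => by
      simp only [Finset.mem_filter, Finset.mem_univ, true_and] at hk ⊢
      exact fun h' => hk (G.trans _ _ _ h h')
  refine ⟨fun h => ?_, mono⟩
  by_contra hn
  have hji := (G.total i j).resolve_left hn
  refine absurd h (not_le.2 (Finset.card_lt_card ?_))
  refine Finset.ssubset_iff_of_subset (fun k hk => ?_) |>.2 ⟨j, by simpa using hn, ?_⟩
  · simp only [Finset.mem_filter, Finset.mem_univ, true_and] at hk ⊢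
    exact fun h' => hk (G.trans _ _ _ hji h')
  · simpa using G.refl j

variable {n : ℕ}

/-- The total preorder whose classes are the blocks of a composition. -/
def ofComposition (q : Composition n) : Face (Fin n) := of q.index

/-- Passing from a word to its preorder forgets only the labels, and these are recovered because the
multiset of letters is that of `q.index` and a multiset has only one increasing arrangement. -/
theorem of_comp_injective {q : Composition n} {σ τ : Perm (Fin n)}
    (h : of (q.index ∘ σ) = of (q.index ∘ τ)) : q.index ∘ σ = q.index ∘ τ := by
  have h1 : Monotone (q.index ∘ (σ * τ⁻¹ : Perm (Fin n))) := by
    intro i j hij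
    have : (of (q.index ∘ τ)).le (τ⁻¹ i) (τ⁻¹ j) := by
      simpa [of_le] using index_mono q hij
    rw [← h] at this
    exact this
  have := Tuple.unique_monotone (τ := 1) h1 (by simpa using index_mono q)
  ext i : 1
  simpa using congrFun this (τ i)

theorem exists_perm_ofComposition (G : Face (Fin n)) :
    ∃ q : Composition n, ∃ ρ : Perm (Fin n), G = perm ρ (ofComposition q) := by
  set σ := Tuple.sort G.rank
  have hm : Monotone (G.rank ∘ σ) := Tuple.monotone_sort _
  have hidx := levelComposition_index hm
  set c := levelComposition hm
  refine ⟨c, σ⁻¹, ?_⟩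
  have hle : ∀ i j, c.index i ≤ c.index j ↔ G.rank (σ i) ≤ G.rank (σ j) := by
    intro i j
    rcases le_total i j with hij | hij
    · exact iff_of_true (index_mono c hij) (hm hij)
    · have := index_mono c hij
      have := hm hij
      constructor <;> intro h1
      · exact ((hidx i j).1 (le_antisymm h1 (index_mono c hij))).le
      · exact ((hidx i j).2 (le_antisymm h1 (hm hij))).le
  ext i j
  change _ ↔ c.index _ ≤ c.index _
  rw [hle, rank_le_rank]
  simp

theorem ofComposition_of_monotone {q : Composition n} {ρ : Perm (Fin n)}
    (h : ∀ i j, i ≤ j → (perm ρ (ofComposition q)).le i j) :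
    perm ρ (ofComposition q) = ofComposition q := by
  have := Tuple.unique_monotone (f := q.index) (σ := ρ) (τ := 1) h (by simpa using index_mono q)
  change of (q.index ∘ ρ) = of q.index
  rw [this]
  rfl

theorem ofComposition_injective : Function.Injective (ofComposition (n := n)) := by
  intro c c' h
  have : ∀ i j, c.index i ≤ c.index j ↔ c'.index i ≤ c'.index j := fun i j =>
    iff_of_eq (congrArg (fun G => G.le i j) h)
  exact composition_ext fun i j => by rw [le_antisymm_iff, le_antisymm_iff, this, this]

theorem eq_of_perm_eq {q q' : Composition n} {ρ : Perm (Fin n)}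
    (h : perm ρ (ofComposition q) = ofComposition q') : q = q' := by
  refine ofComposition_injective ?_
  rw [← h, ofComposition_of_monotone]
  intro i j hij
  rw [h]
  exact index_mono q' hij

/-- The composition of block sizes of a total preorder. -/
noncomputable def type (G : Face (Fin n)) : Composition n := G.exists_perm_ofComposition.choose

theorem type_eq_iff {G : Face (Fin n)} {q : Composition n} :
    G.type = q ↔ ∃ ρ : Perm (Fin n), G = perm ρ (ofComposition q) := by
  refine ⟨fun h => h ▸ G.exists_perm_ofComposition.choose_spec, ?_⟩
  rintro ⟨ρ, h⟩
  obtain ⟨σ, hσ⟩ := G.exists_perm_ofComposition.choose_spec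
  refine eq_of_perm_eq (ρ := σ * ρ⁻¹) ?_
  rw [← perm_perm]
  rw [type, ← hσ, h, perm_perm, mul_inv_cancel]
  rfl

theorem type_ofComposition (q : Composition n) : (ofComposition q).type = q :=
  type_eq_iff.2 ⟨1, rfl⟩

theorem type_perm (ρ : Perm (Fin n)) (G : Face (Fin n)) : (perm ρ G).type = G.type := by
  obtain ⟨σ, hσ⟩ := type_eq_iff.1 (rfl : G.type = _)
  exact type_eq_iff.2 ⟨σ * ρ, by rw [← perm_perm, ← hσ]⟩

/-- Types are thus the orbits of the symmetric group on faces; this is why invariants have the orbit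
sums as a basis. -/
theorem type_eq_type_iff {G H : Face (Fin n)} : G.type = H.type ↔ ∃ ρ, G = perm ρ H := by
  refine ⟨fun h => ?_, ?_⟩
  · obtain ⟨σ, hσ⟩ := type_eq_iff.1 h
    obtain ⟨τ, hτ⟩ := type_eq_iff.1 (rfl : H.type = _)
    refine ⟨τ⁻¹ * σ, ?_⟩
    conv_rhs => rw [hτ, perm_perm, mul_inv_cancel_left]
    exact hσ
  · rintro ⟨ρ, rfl⟩
    exact type_perm ρ H

/-- The product of faces realizes the common refinement. -/
theorem ofComposition_mul {r q : Composition n} (g : Word r q) :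
    ofComposition r * of g.1 = ofComposition g.comp := by
  ext i j
  have key : (ofComposition r * of g.1).le i j ↔
      toLex (r.index i, g.1 i) ≤ toLex (r.index j, g.1 j) := by
    rw [mul_le, Prod.Lex.toLex_le_toLex]
    change (r.index i ≤ r.index j ∧ (r.index j ≤ r.index i → g.1 i ≤ g.1 j)) ↔ _
    rw [lt_iff_le_not_ge, le_antisymm_iff]
    simp only
    tauto
  rw [key]
  change _ ↔ g.comp.index i ≤ g.comp.index j
  rcases le_total i j with hij | hij
  · exact iff_of_true (g.2.2 hij) (index_mono _ hij)
  · have h1 := g.2.2 hij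
    have h2 := index_mono g.comp hij
    have h3 := g.comp_index i j
    constructor <;> intro h
    · have := le_antisymm h h1
      simp only [EmbeddingLike.apply_eq_iff_eq, Prod.mk.injEq] at this
      exact (h3.2 this).le
    · have := h3.1 (le_antisymm h h2)
      rw [this.1, this.2]

open Classical in
/-- The number of factorizations of a face with factors of given types. -/
theorem card_factorizations (r q : Composition n) (K : Face (Fin n)) :
    (Finset.univ.filter fun x : Face (Fin n) × Face (Fin n) =>
      x.1.type = r ∧ x.2.type = q ∧ x.1 * x.2 = K).card =
    (Finset.univ.filter fun g : Word r q => g.comp = K.type).card := by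
  symm
  obtain ⟨ρ, hρ⟩ := type_eq_iff.1 (rfl : K.type = _)
  refine Finset.card_bij (fun g _ => (perm ρ (ofComposition r), perm ρ (of g.1))) ?_ ?_ ?_
  · intro g hg
    simp only [Finset.mem_filter, Finset.mem_univ, true_and] at hg ⊢
    obtain ⟨σ, hσ⟩ := g.2.1
    refine ⟨by rw [type_perm, type_ofComposition], ?_, ?_⟩
    · rw [type_perm]
      exact type_eq_iff.2 ⟨σ, by rw [hσ]; rfl⟩
    · rw [← map_mul, ofComposition_mul, hg, ← hρ]
  · intro g _ g' _ h
    have h2 := (perm ρ).injective (Prod.ext_iff.1 h).2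
    obtain ⟨σ, hσ⟩ := g.2.1
    obtain ⟨σ', hσ'⟩ := g'.2.1
    rw [hσ, hσ'] at h2
    exact Subtype.ext (by rw [hσ, hσ', of_comp_injective h2])
  · rintro ⟨G, H⟩ h
    simp only [Finset.mem_filter, Finset.mem_univ, true_and] at h
    obtain ⟨hG, hH, hGH⟩ := h
    obtain ⟨G, rfl⟩ := (perm ρ).surjective G
    obtain ⟨H, rfl⟩ := (perm ρ).surjective H
    rw [type_perm] at hG hH
    rw [← map_mul, hρ] at hGH
    have hGH := (perm ρ).injective hGH
    obtain ⟨σ, rfl⟩ := type_eq_iff.1 hG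
    obtain ⟨τ, rfl⟩ := type_eq_iff.1 hH
    -- After transport by ρ the product is a standard face, so its first factor is weakly increasing
    -- and hence standard as well. The second factor then increases on the blocks of r, which is the
    -- condition defining `Word r q`.
    have hle : ∀ i j, i ≤ j →
        (perm σ (ofComposition r) * perm τ (ofComposition q)).le i j := by
      intro i j hij
      rw [hGH]
      exact index_mono _ hij
    have hr := ofComposition_of_monotone (fun i j hij => (hle i j hij).1)
    rw [hr] at hGH hle ⊢
    have hm : Monotone fun i => toLex (r.index i, (q.index ∘ τ) i) := by
      intro i j hij
      rw [Prod.Lex.toLex_le_toLex]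
      have h1 : r.index i ≤ r.index j := (hle i j hij).1
      rcases h1.lt_or_eq with h | h
      · exact Or.inl h
      · exact Or.inr ⟨h, (hle i j hij).2 h.ge⟩
    refine ⟨⟨q.index ∘ τ, ⟨τ, rfl⟩, hm⟩, ?_, rfl⟩
    simp only [Finset.mem_filter, Finset.mem_univ, true_and]
    refine ofComposition_injective ?_
    rw [← hGH, ← ofComposition_mul]
    rfl

end Face

/-! ### The descent algebra inside the face algebra -/

section FaceAlgebra

variable (F : Type u) [Field F] {n : ℕ}

/-- The linear map sending `Ξ^q` to the sum of the faces of type `q`. -/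
noncomputable def toFacesLinear : descentAlgebra F n →ₗ[F] MonoidAlgebra F (Face (Fin n)) where
  toFun x := .ofCoeff (Finsupp.equivFunOnFinite.symm fun G => (xiBasis F n).repr x G.type)
  map_add' x y := by ext G; simp
  map_smul' c x := by ext G; simp

theorem toFacesLinear_coeff (x : descentAlgebra F n) (G : Face (Fin n)) :
    (toFacesLinear F x).coeff G = (xiBasis F n).repr x G.type := rfl

/-- At a face K, Solomon's rule counts the words whose refinement has the type of K, while the
product of orbit sums counts the factorizations of K into faces of types r and q. -/
theorem toFacesLinear_mul_xi (r q : Composition n) :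
    toFacesLinear F (xi F r * xi F q) = toFacesLinear F (xi F r) * toFacesLinear F (xi F q) := by
  classical
  ext K
  rw [toFacesLinear_coeff, xi_mul, map_sum, MonoidAlgebra.coeff_mul_antidiag _ _ _
    (Finset.univ.filter fun x => x.1 * x.2 = K) (by simp)]
  have := congrArg (Nat.cast (R := F)) (Face.card_factorizations r q K)
  simp only [toFacesLinear_coeff, ← xiBasis_apply, Module.Basis.repr_self, Finsupp.single_apply,
    Finsupp.finsetSum_apply]
  rw [Finset.sum_boole, ← this, Finset.sum_filter, ← Finset.sum_boole]
  refine Finset.sum_congr rfl fun x _ => ?_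
  by_cases h1 : x.1.type = r <;> by_cases h2 : x.2.type = q <;> by_cases h3 : x.1 * x.2 = K <;>
    simp [h1, h2, h3, eq_comm (a := r), eq_comm (a := q)]

/-- The embedding of the descent algebra into the algebra of the face monoid: `Ξ^q` goes to the
sum of the faces of type `q`. -/
noncomputable def toFaces : descentAlgebra F n →ₐ[F] MonoidAlgebra F (Face (Fin n)) :=
  AlgHom.ofLinearMap (toFacesLinear F)
    (by
      classical
      obtain ⟨c, hc, h1⟩ := exists_Xi_one F n
      have h1' : (1 : descentAlgebra F n) = xiBasis F n c := by
        rw [xiBasis_apply]; exact Subtype.ext h1.symm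
      have hc1 : Face.ofComposition c = 1 := by
        ext i j
        exact iff_of_true (hc i j).le trivial
      ext G
      -- The one-block face is fixed by all permutations, so it is the only face of its type.
      have key : (c = G.type) = (1 = G) := by
        refine propext ⟨fun h => ?_, fun h => ?_⟩
        · obtain ⟨ρ, hρ⟩ := Face.type_eq_iff.1 h.symm
          rw [hρ, hc1, map_one]
        · rw [← h, ← hc1, Face.type_ofComposition]
      rw [h1', MonoidAlgebra.one_def]
      simp [toFacesLinear_coeff, Finsupp.single_apply, key])
    (by
      have h : (LinearMap.mul F (descentAlgebra F n)).compr₂ (toFacesLinear F) =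
          (LinearMap.mul F (MonoidAlgebra F (Face (Fin n)))).compl₁₂
            (toFacesLinear F) (toFacesLinear F) := by
        refine (xiBasis F n).ext fun r => (xiBasis F n).ext fun q => ?_
        simp only [LinearMap.compr₂_apply, LinearMap.mul_apply', LinearMap.compl₁₂_apply,
          xiBasis_apply]
        exact toFacesLinear_mul_xi F r q
      exact fun x y => LinearMap.congr_fun (LinearMap.congr_fun h x) y)

theorem toFaces_coeff (x : descentAlgebra F n) (G : Face (Fin n)) :
    (toFaces F x).coeff G = (xiBasis F n).repr x G.type := rfl

theorem toFaces_injective : Function.Injective (toFaces F (n := n)) := by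
  intro x y h
  refine (xiBasis F n).repr.injective (Finsupp.ext fun q => ?_)
  rw [← Face.type_ofComposition q, ← toFaces_coeff, ← toFaces_coeff, h]

/-- The image of the descent algebra consists of the invariants of the symmetric group. -/
theorem exists_toFaces_eq {a : MonoidAlgebra F (Face (Fin n))}
    (h : ∀ ρ G, a.coeff (Face.perm ρ G) = a.coeff G) : ∃ x, toFaces F x = a := by
  refine ⟨(xiBasis F n).repr.symm
    (Finsupp.equivFunOnFinite.symm fun q => a.coeff (Face.ofComposition q)), ?_⟩
  ext G
  obtain ⟨ρ, hρ⟩ := Face.type_eq_iff.1 (rfl : G.type = _)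
  rw [toFaces_coeff, LinearEquiv.apply_symm_apply]
  conv_rhs => rw [hρ, h]
  rfl

end FaceAlgebra

/-! ### Restricting and extending faces -/

/-- The juxtaposition of a permutation of the first `m` and a permutation of the last `s`
points. -/
def sumPerm {m s : ℕ} (ρ : Perm (Fin m)) (τ : Perm (Fin s)) : Perm (Fin (m + s)) :=
  finSumFinEquiv.permCongr (Equiv.sumCongr ρ τ)

@[simp]
theorem sumPerm_castAdd {m s : ℕ} (ρ : Perm (Fin m)) (τ : Perm (Fin s)) (i : Fin m) :
    sumPerm ρ τ (Fin.castAdd s i) = Fin.castAdd s (ρ i) := by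
  simp [sumPerm, Equiv.permCongr_apply]

@[simp]
theorem sumPerm_natAdd {m s : ℕ} (ρ : Perm (Fin m)) (τ : Perm (Fin s)) (i : Fin s) :
    sumPerm ρ τ (Fin.natAdd m i) = Fin.natAdd m (τ i) := by
  simp [sumPerm, Equiv.permCongr_apply]

theorem card_filter_add {m s : ℕ} (P : Fin (m + s) → Prop) [DecidablePred P] :
    (Finset.univ.filter P).card = (Finset.univ.filter fun i => P (Fin.castAdd s i)).card +
      (Finset.univ.filter fun i => P (Fin.natAdd m i)).card := by
  simp only [Finset.card_filter, Fin.sum_univ_add]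

namespace Face

variable {m s : ℕ}

/-- The last `s` points lie in a single class. -/
def Joins (s : ℕ) (G : Face (Fin (m + s))) : Prop :=
  ∀ a b, G.le (Fin.natAdd m a) (Fin.natAdd m b)

/-- The equivalence classes of a product are the intersections of the classes of the factors.
Consequently, killing the faces that do not join is compatible with multiplication. -/
theorem joins_mul {G H : Face (Fin (m + s))} : Joins s (G * H) ↔ Joins s G ∧ Joins s H := by
  refine ⟨fun h => ⟨fun a b => (h a b).1, fun a b => (h a b).2 (h b a).1⟩, ?_⟩
  exact fun h a b => ⟨h.1 a b, fun _ => h.2 a b⟩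

theorem joins_perm (ρ : Perm (Fin m)) (G : Face (Fin (m + s))) :
    Joins s (perm (sumPerm ρ 1) G) ↔ Joins s G := by
  simp [Joins, perm_le]

theorem comap_castAdd_perm (ρ : Perm (Fin m)) (τ : Perm (Fin s)) (G : Face (Fin (m + s))) :
    comap (Fin.castAdd s) (perm (sumPerm ρ τ) G) = perm ρ (comap (Fin.castAdd s) G) := by
  ext i j
  simp [comap_le, perm_le]

open Classical in
/-- The number of minimal elements. -/
noncomputable def minCount {ι : Type*} [Fintype ι] (G : Face ι) : ℕ :=
  (Finset.univ.filter fun i => ∀ j, G.le i j).card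

theorem minCount_eq {ι : Type*} [Fintype ι] (G : Face ι) [DecidablePred fun i => ∀ j, G.le i j] :
    G.minCount = (Finset.univ.filter fun i => ∀ j, G.le i j).card := by
  unfold minCount
  congr!

theorem minCount_perm {ι : Type*} [Fintype ι] (ρ : Perm ι) (G : Face ι) :
    (perm ρ G).minCount = G.minCount := by
  classical
  refine Finset.card_equiv ρ fun i => ?_
  simp only [Finset.mem_filter, Finset.mem_univ, true_and, perm_le]
  exact ρ.forall_congr_left.trans (by simp)

theorem minCount_eq_of_type_eq {n : ℕ} {G H : Face (Fin n)} (h : G.type = H.type) :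
    G.minCount = H.minCount := by
  obtain ⟨ρ, rfl⟩ := type_eq_type_iff.1 h
  exact minCount_perm ρ H

theorem rank_perm {ι : Type*} [Fintype ι] (ρ : Perm ι) (G : Face ι) (i : ι) :
    (perm ρ G).rank i = G.rank (ρ i) := by
  classical
  refine Finset.card_equiv ρ fun j => ?_
  simp [perm_le]

theorem rank_eq_zero {ι : Type*} [Fintype ι] {G : Face ι} {i : ι} :
    G.rank i = 0 ↔ ∀ j, G.le i j := by
  simp [rank, Finset.filter_eq_empty_iff]

theorem exists_le {n : ℕ} (hn : 0 < n) (G : Face (Fin n)) : ∃ i, ∀ j, G.le i j := by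
  have : Nonempty (Fin n) := ⟨⟨0, hn⟩⟩
  obtain ⟨i, hi⟩ := Finite.exists_min G.rank
  exact ⟨i, fun j => G.rank_le_rank.1 (hi j)⟩

/-- The total preorder on `m + s` points obtained by adding `s` points to the lowest class. -/
noncomputable def extend (s : ℕ) (G : Face (Fin m)) : Face (Fin (m + s)) :=
  of (Fin.addCases G.rank fun _ => 0)

section extend

variable (G : Face (Fin m)) (i j : Fin m) (a b : Fin s)

@[simp]
theorem extend_castAdd_castAdd :
    (extend s G).le (Fin.castAdd s i) (Fin.castAdd s j) ↔ G.le i j := by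
  simp [extend, of_le, rank_le_rank]

@[simp]
theorem extend_castAdd_natAdd :
    (extend s G).le (Fin.castAdd s i) (Fin.natAdd m b) ↔ ∀ j, G.le i j := by
  simp [extend, of_le, rank_eq_zero]

@[simp]
theorem extend_natAdd (k : Fin (m + s)) : (extend s G).le (Fin.natAdd m a) k := by
  simp [extend, of_le]

theorem joins_extend : Joins s (extend s G) := fun _ _ => extend_natAdd ..

theorem comap_extend : comap (Fin.castAdd s) (extend s G) = G := by
  ext i j
  simp [comap_le]

theorem minCount_extend : (extend s G).minCount = G.minCount + s := by
  classical
  rw [minCount_eq, card_filter_add]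
  congr 1
  · rw [minCount_eq]
    congr 1
    ext i
    simp only [Finset.mem_filter, Finset.mem_univ, true_and, Fin.forall_fin_add,
      extend_castAdd_castAdd, extend_castAdd_natAdd]
    tauto
  · simp

theorem rank_extend_natAdd : (extend s G).rank (Fin.natAdd m a) = 0 := by
  simp [rank_eq_zero]

theorem rank_extend_castAdd :
    (extend s G).rank (Fin.castAdd s i) = if G.rank i = 0 then 0 else G.rank i + s := by
  classical
  rw [rank, card_filter_add]
  simp only [extend_castAdd_castAdd, extend_castAdd_natAdd, ← rank_eq_zero]
  split_ifs with h
  · have h' := rank_eq_zero.1 h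
    simp [h, h']
  · rw [Finset.filter_true_of_mem fun _ _ => h, Finset.card_univ, Fintype.card_fin]
    rfl

variable {G} in
-- A type is determined by how many points have each rank. Extension keeps rank 0, raises every
-- other rank by s and adds s points of rank 0, so the original distribution can be read off.
theorem type_eq_of_extend {H : Face (Fin m)} (h : (extend s G).type = (extend s H).type) :
    G.type = H.type := by
  classical
  obtain ⟨ρ, hρ⟩ := type_eq_type_iff.1 h
  have hr : ∀ i, (extend s G).rank i = (extend s H).rank (ρ i) := fun i => by
    rw [hρ, rank_perm]
  let φ : ℕ → ℕ := fun r => if r = 0 then 0 else r + s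
  have hφ : Function.Injective φ := by
    intro a b hab
    simp only [φ] at hab
    split_ifs at hab <;> omega
  have hcard : ∀ r, (Finset.univ.filter fun i => G.rank i = r).card =
      (Finset.univ.filter fun i => H.rank i = r).card := by
    intro r
    have h1 : (Finset.univ.filter fun i => (extend s G).rank i = φ r).card =
        (Finset.univ.filter fun i => (extend s H).rank i = φ r).card :=
      Finset.card_equiv ρ fun i => by simp [hr]
    rw [card_filter_add, card_filter_add] at h1
    simp only [rank_extend_natAdd, rank_extend_castAdd] at h1
    have h2 : ∀ k, ((if k = 0 then 0 else k + s) = φ r) = (k = r) := fun k =>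
      propext (hφ.eq_iff (a := k))
    simp only [h2] at h1
    omega
  have e : ∀ r, {i // G.rank i = r} ≃ {i // H.rank i = r} := fun r =>
    Fintype.equivOfCardEq (by rw [Fintype.card_subtype, Fintype.card_subtype, hcard])
  let σ : Perm (Fin m) := (Equiv.sigmaFiberEquiv G.rank).symm.trans
    ((Equiv.sigmaCongrRight e).trans (Equiv.sigmaFiberEquiv H.rank))
  have hσ : ∀ i, H.rank (σ i) = G.rank i := fun i => (e (G.rank i) ⟨i, rfl⟩).2
  refine type_eq_type_iff.2 ⟨σ, ?_⟩
  ext i j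
  rw [perm_le, ← rank_le_rank, ← rank_le_rank, hσ, hσ]

end extend

/-- Among the faces of the type of `extend s G` joining the last `s` points, those with few
minimal points after restriction are themselves obtained by `extend`. -/
theorem eq_extend (hm : 0 < m) (hs : 1 ≤ s) {G : Face (Fin m)} {K : Face (Fin (m + s))}
    (hK : Joins s K) (ht : K.type = (extend s G).type)
    (hle : (comap (Fin.castAdd s) K).minCount ≤ G.minCount) :
    K = extend s (comap (Fin.castAdd s) K) := by
  classical
  have hc := minCount_eq_of_type_eq ht
  rw [minCount_extend G, minCount_eq, card_filter_add] at hc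
  have hG : 0 < G.minCount := by
    obtain ⟨i, hi⟩ := exists_le hm G
    rw [minCount_eq]
    exact Finset.card_pos.2 ⟨i, by simpa using hi⟩
  -- If the last s points are lowest, the lowest class has more than s points, so it contains one of
  -- the first m, and K is an extension. Otherwise all minimal points are among the first m, so the
  -- restriction has `G.minCount + s` of them, too many since s ≥ 1.
  by_cases hlow : ∀ (a : Fin s) (k : Fin m), K.le (Fin.natAdd m a) (Fin.castAdd s k)
  · obtain ⟨k, hk⟩ : ∃ k, ∀ j, K.le (Fin.castAdd s k) j := by
      by_contra! hno
      rw [Finset.filter_false_of_mem (by simpa using hno), Finset.card_empty, zero_add] at hc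
      have := (Finset.card_le_univ
        (Finset.univ.filter fun a : Fin s => ∀ j, K.le (Fin.natAdd m a) j))
      rw [Fintype.card_fin] at this
      omega
    ext i j
    refine Fin.addCases (fun i => ?_) (fun a => ?_) i
    · refine Fin.addCases (fun j => ?_) (fun b => ?_) j
      · simp [comap_le]
      · rw [extend_castAdd_natAdd]
        refine ⟨fun h j => K.trans _ _ _ h (hlow b j), fun h => K.trans _ _ _ (h k) (hk _)⟩
    · refine iff_of_true ?_ (extend_natAdd _ _ _)
      exact Fin.addCases (fun j => hlow a j) (fun b => hK a b) j
  · exfalso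
    push Not at hlow
    obtain ⟨a, k, hk⟩ := hlow
    have hk' := (K.total (Fin.natAdd m a) (Fin.castAdd s k)).resolve_left hk
    have h2 : (Finset.univ.filter fun b : Fin s => ∀ j, K.le (Fin.natAdd m b) j).card = 0 := by
      rw [Finset.card_eq_zero, Finset.filter_eq_empty_iff]
      exact fun b _ h => hk (K.trans _ _ _ (hK a b) (h _))
    have h1 : (Finset.univ.filter fun i : Fin m => ∀ j, K.le (Fin.castAdd s i) j).card =
        (comap (Fin.castAdd s) K).minCount := by
      rw [minCount_eq]
      congr 1
      ext i
      simp only [Finset.mem_filter, Finset.mem_univ, true_and, comap_le]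
      refine ⟨fun h j => h _, fun h => ?_⟩
      refine Fin.addCases h fun b => ?_
      exact K.trans _ _ _ (h k) (K.trans _ _ _ hk' (hK a b))
    omega

end Face

/-! ### The surjection of descent algebras -/

section Restriction

variable (F : Type u) [Field F] (m s : ℕ)

open Classical in
/-- The algebra homomorphism that restricts faces joining the last `s` points to the first `m`
points, and kills all other faces. -/
noncomputable def restrictFaces :
    MonoidAlgebra F (Face (Fin (m + s))) →ₐ[F] MonoidAlgebra F (Face (Fin m)) :=
  MonoidAlgebra.lift F _ _
    { toFun := fun G => if G.Joins s then .single (Face.comap (Fin.castAdd s) G) 1 else 0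
      map_one' := by
        have : (1 : Face (Fin (m + s))).Joins s := fun _ _ => trivial
        rw [if_pos this, map_one]
        rfl
      map_mul' := fun G H => by
        by_cases hG : G.Joins s <;> by_cases hH : H.Joins s <;> simp [Face.joins_mul, hG, hH] }

variable {m s}

open Classical in
theorem restrictFaces_coeff (a : MonoidAlgebra F (Face (Fin (m + s)))) (H : Face (Fin m)) :
    (restrictFaces F m s a).coeff H =
      ∑ G with G.Joins s ∧ Face.comap (Fin.castAdd s) G = H, a.coeff G := by
  rw [restrictFaces, MonoidAlgebra.lift_apply, Finsupp.sum_fintype _ _ (by simp),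
    MonoidAlgebra.coeff_sum, Finsupp.finsetSum_apply, Finset.sum_filter]
  refine Finset.sum_congr rfl fun G _ => ?_
  by_cases hG : G.Joins s <;> simp [hG, Finsupp.single_apply]

/-- Extending a permutation of the first m points by the identity permutes the fibres of restriction
and preserves types, so invariants go to invariants. -/
theorem restrictFaces_toFaces_mem (x : descentAlgebra F (m + s)) :
    restrictFaces F m s (toFaces F x) ∈ (toFaces F (n := m)).range := by
  classical
  refine exists_toFaces_eq F fun ρ H => ?_
  rw [restrictFaces_coeff, restrictFaces_coeff]
  symm
  refine Finset.sum_equiv (Face.perm (sumPerm ρ 1)).toEquiv (fun G => ?_) (fun G _ => ?_)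
  · simp [Face.joins_perm, Face.comap_castAdd_perm]
  · rw [toFaces_coeff, toFaces_coeff]
    exact congrArg _ (Face.type_perm _ G).symm

/-- The homomorphism `D_{m+s}(F) → D_m(F)`, under which `Ξ^q` goes to the sum of the `Ξ^r` for `r`
obtained by diminishing a part of `q` by `s`. -/
noncomputable def descentRestrict : descentAlgebra F (m + s) →ₐ[F] descentAlgebra F m :=
  (AlgEquiv.ofInjective (toFaces F (n := m)) (toFaces_injective F)).symm.toAlgHom.comp
    (((restrictFaces F m s).comp (toFaces F)).codRestrict _ (restrictFaces_toFaces_mem F))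

theorem toFaces_descentRestrict (x : descentAlgebra F (m + s)) :
    toFaces F (descentRestrict F x) = restrictFaces F m s (toFaces F x) :=
  congrArg Subtype.val ((AlgEquiv.ofInjective _ (toFaces_injective F)).apply_symm_apply
    ⟨_, restrictFaces_toFaces_mem F x⟩)

theorem xi_eq_one (r : Composition 0) : xi F r = 1 := by
  obtain ⟨c, -, h1⟩ := exists_Xi_one F 0
  have : r = c := composition_ext fun i => i.elim0
  exact this ▸ Subtype.ext h1

open Classical in
-- Unitriangularity with respect to the size of the lowest class: the coefficient counts joining
-- faces of the extended type that restrict to the standard face of q, and `Face.eq_extend` leaves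
-- only the extension of that face.
theorem repr_descentRestrict_extend (hm : 0 < m) (hs : 1 ≤ s) {r q : Composition m}
    (h : (Face.ofComposition q).minCount ≤ (Face.ofComposition r).minCount) :
    (xiBasis F m).repr
      (descentRestrict F (xi F (Face.extend s (Face.ofComposition r)).type)) q =
      if r = q then 1 else 0 := by
  rw [← Face.type_ofComposition q, ← toFaces_coeff, toFaces_descentRestrict,
    restrictFaces_coeff, Face.type_ofComposition]
  simp only [toFaces_coeff, ← xiBasis_apply, Module.Basis.repr_self, Finsupp.single_apply]
  have key : ∀ G : Face (Fin (m + s)), G.Joins s →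
      Face.comap (Fin.castAdd s) G = Face.ofComposition q →
      (Face.extend s (Face.ofComposition r)).type = G.type →
      G = Face.extend s (Face.ofComposition q) ∧ r = q := by
    intro G h1 h2 h3
    have e := Face.eq_extend hm hs h1 h3.symm (by rwa [h2])
    rw [h2] at e
    refine ⟨e, ?_⟩
    rw [e] at h3
    simpa [Face.type_ofComposition] using Face.type_eq_of_extend h3
  split_ifs with hrq
  · subst hrq
    rw [Finset.sum_eq_single (Face.extend s (Face.ofComposition r))]
    · simp
    · intro G hG hne
      obtain ⟨h1, h2⟩ := (Finset.mem_filter.1 hG).2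
      exact if_neg fun h3 => hne (key G h1 h2 h3).1
    · intro hno
      simp [Face.joins_extend, Face.comap_extend] at hno
  · refine Finset.sum_eq_zero fun G hG => ?_
    obtain ⟨h1, h2⟩ := (Finset.mem_filter.1 hG).2
    exact if_neg fun h3 => hrq (key G h1 h2 h3).2

theorem descentRestrict_surjective (hs : 1 ≤ s) :
    Function.Surjective (descentRestrict F (m := m) (s := s)) := by
  classical
  have hxi : ∀ r : Composition m, xi F r ∈
      LinearMap.range (descentRestrict F (s := s)).toLinearMap := by
    rcases Nat.eq_zero_or_pos m with rfl | hm
    · intro r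
      rw [xi_eq_one]
      exact ⟨1, map_one (descentRestrict F)⟩
    intro r
    -- The image of the chosen preimage differs from Ξ^r only by terms Ξ^q with a larger lowest
    -- class, which are in the range by induction.
    induction hN : m - (Face.ofComposition r).minCount using Nat.strong_induction_on generalizing r
      with
    | _ N ih =>
    subst hN
    set x := xi F (Face.extend s (Face.ofComposition r)).type with hx
    have hy : descentRestrict F x - xi F r ∈
        LinearMap.range (descentRestrict F (s := s)).toLinearMap := by
      rw [← (xiBasis F m).sum_repr (descentRestrict F x - xi F r)]
      refine Submodule.sum_mem _ fun q _ => ?_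
      by_cases hq : (Face.ofComposition q).minCount ≤ (Face.ofComposition r).minCount
      · have : (xiBasis F m).repr (descentRestrict F x - xi F r) q = 0 := by
          rw [map_sub, Finsupp.sub_apply, hx, repr_descentRestrict_extend F hm hs hq,
            ← xiBasis_apply, Module.Basis.repr_self, Finsupp.single_apply, sub_self]
        rw [this, zero_smul]
        exact Submodule.zero_mem _
      · refine Submodule.smul_mem _ _ ?_
        rw [xiBasis_apply]
        refine ih _ ?_ q rfl
        have : (Face.ofComposition q).minCount ≤ m := by
          rw [Face.minCount_eq]
          exact (Finset.card_le_univ _).trans (Fintype.card_fin m).le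
        omega
    have := Submodule.sub_mem _ (LinearMap.mem_range_self
      (descentRestrict F (s := s)).toLinearMap x) hy
    simpa using this
  intro y
  have : y ∈ LinearMap.range (descentRestrict F (s := s)).toLinearMap := by
    rw [← (xiBasis F m).sum_repr y]
    refine Submodule.sum_mem _ fun q _ => Submodule.smul_mem _ _ ?_
    rw [xiBasis_apply]
    exact hxi q
  exact this

end Restriction

/-! ### Faces fixed by a permutation -/

namespace Face

variable {n : ℕ}

theorem perm_eq_self_iff {G : Face (Fin n)} {π : Perm (Fin n)} :
    perm π G = G ↔ ∀ i, G.rank (π i) = G.rank i := by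
  refine ⟨fun h i => by rw [← rank_perm, h], fun h => ?_⟩
  ext i j
  rw [perm_le, ← rank_le_rank, ← rank_le_rank, h, h]

/-- The permutations fixing a face. -/
def stabilizer (G : Face (Fin n)) : Subgroup (Perm (Fin n)) where
  carrier := {π | perm π G = G}
  one_mem' := rfl
  mul_mem' := by
    intro π σ hπ hσ
    change perm (π * σ) G = G
    rw [← perm_perm, hπ, hσ]
  inv_mem' := by
    intro π hπ
    change perm π⁻¹ G = G
    rw [← perm_symm, MulEquiv.symm_apply_eq]
    exact hπ.symm

theorem mem_stabilizer {G : Face (Fin n)} {π : Perm (Fin n)} :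
    π ∈ G.stabilizer ↔ perm π G = G := Iff.rfl

/-- Together with `fixedCosets_eq` this turns the Young character into a count of fixed faces. -/
theorem card_fixedWord (q : Composition n) (π : Perm (Fin n)) :
    Nat.card (FixedWord q.index π) =
      Nat.card {G : Face (Fin n) // G.type = q ∧ π ∈ G.stabilizer} := by
  refine Nat.card_eq_of_bijective (fun w => ⟨of w.1, ?_, ?_⟩) ⟨?_, ?_⟩
  · obtain ⟨_, ⟨ρ, rfl⟩, -⟩ := w
    exact type_eq_iff.2 ⟨ρ, rfl⟩
  · change of (w.1 ∘ π) = of w.1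
    rw [w.2.2]
  · rintro ⟨_, ⟨ρ, rfl⟩, hρ⟩ ⟨_, ⟨ρ', rfl⟩, hρ'⟩ h
    exact Subtype.ext (of_comp_injective (congrArg Subtype.val h))
  · rintro ⟨G, hG, hπ⟩
    obtain ⟨ρ, rfl⟩ := type_eq_iff.1 hG
    have : of (q.index ∘ (ρ * π : Perm (Fin n))) = of (q.index ∘ ρ) := hπ
    exact ⟨⟨q.index ∘ ρ, ⟨ρ, rfl⟩, of_comp_injective this⟩, rfl⟩

theorem comp_finRotate_eq {s : ℕ} {α : Type*} {f : Fin s → α}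
    (h : ∀ a, f (finRotate s a) = f a) (a b : Fin s) : f a = f b := by
  cases s with
  | zero => exact a.elim0
  | succ s =>
    have : ∀ a, f a = f 0 := by
      intro a
      induction a using Fin.induction with
      | zero => rfl
      | succ i ih => rw [← ih, ← h i.castSucc, finRotate_apply, Fin.coeSucc_eq_succ]
    rw [this a, this b]

/-- A fixed face has constant rank on orbits, and the rotation is transitive on the last s points.
-/
theorem mem_stabilizer_sumPerm {m s : ℕ} {G : Face (Fin (m + s))} {π : Perm (Fin m)} :
    sumPerm π (finRotate s) ∈ G.stabilizer ↔
      G.Joins s ∧ π ∈ (comap (Fin.castAdd s) G).stabilizer := by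
  have hrank : ∀ {k} {H : Face (Fin k)} {i j}, H.rank i = H.rank j ↔ H.le i j ∧ H.le j i := by
    intro k H i j
    rw [le_antisymm_iff, rank_le_rank, rank_le_rank]
  rw [mem_stabilizer, mem_stabilizer, perm_eq_self_iff, perm_eq_self_iff, Fin.forall_fin_add,
    and_comm]
  simp only [sumPerm_castAdd, sumPerm_natAdd]
  refine and_congr ⟨fun h a b => ?_, fun h a => hrank.2 ⟨h _ _, h _ _⟩⟩
    (forall_congr' fun i => by rw [hrank, hrank]; rfl)
  rw [← rank_le_rank]
  exact (comp_finRotate_eq (f := fun a => G.rank (Fin.natAdd m a)) h a b).le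

end Face

/-! ### Existence and use of p'-parts -/

section CoprimePart

variable {G : Type*} [Group G]

/-- A subgroup that contains a product of commuting elements of coprime orders contains the
factors. -/
theorem mul_mem_iff_of_coprime {u h : G} (hc : Commute u h)
    (hco : (orderOf u).Coprime (orderOf h)) (S : Subgroup G) : u * h ∈ S ↔ u ∈ S ∧ h ∈ S := by
  refine ⟨fun hm => ?_, fun hm => S.mul_mem hm.1 hm.2⟩
  have hu : u ∈ S := by
    -- The power of u * h with exponent the order of h is a power of u which, by coprimality,
    -- generates the same cyclic group as u.
    obtain ⟨k, hk⟩ := exists_pow_eq_self_of_coprime hco.symm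
    rw [← hk]
    refine S.pow_mem ?_ _
    have := S.pow_mem hm (orderOf h)
    rwa [hc.mul_pow, pow_orderOf_eq_one h, mul_one] at this
  exact ⟨hu, by simpa using S.mul_mem (S.inv_mem hu) hm⟩

theorem coprime_of_primeTo [Finite G] {p : ℕ} (hp : p.Prime ∨ p = 0) {u h : G}
    (hu : ∃ k : ℕ, orderOf u = p ^ k) (hh : ¬ p ∣ orderOf h) :
    (orderOf u).Coprime (orderOf h) := by
  obtain ⟨k, hk⟩ := hu
  rcases hp with hp | rfl
  · rw [hk]
    exact Nat.Coprime.pow_left _ ((Nat.Prime.coprime_iff_not_dvd hp).2 hh)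
  · have := orderOf_pos u
    rcases k with - | k
    · simp [hk]
    · simp [hk] at this

theorem exists_isPrimeToPart [Finite G] {p : ℕ} (hp : p.Prime ∨ p = 0) (g : G) :
    ∃ h, IsPrimeToPart p g h := by
  have hpos := orderOf_pos g
  rcases hp with hp | rfl
  · obtain ⟨a, m, hm, hN⟩ := Nat.exists_eq_pow_mul_and_not_dvd hpos.ne' p hp.ne_one
    have hco : (p ^ a).Coprime m := Nat.Coprime.pow_left _ ((Nat.Prime.coprime_iff_not_dvd hp).2 hm)
    -- With l + k ≡ 1 modulo the order of g, the factors g ^ l and g ^ k are the p-part and the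
    -- p'-part.
    obtain ⟨k, hk0, hk1⟩ := Nat.chineseRemainder hco 0 1
    obtain ⟨l, hl1, hl0⟩ := Nat.chineseRemainder hco 1 0
    have hlk : l + k ≡ 1 [MOD orderOf g] := by
      rw [hN, ← Nat.modEq_and_modEq_iff_modEq_mul hco]
      exact ⟨by simpa using hl1.add hk0, by simpa using hl0.add hk1⟩
    refine ⟨g ^ k, g ^ l, ?_, (Commute.refl g).pow_pow _ _, ?_, ?_⟩
    · rw [← pow_add, pow_eq_pow_iff_modEq.2 hlk, pow_one]
    · have : orderOf (g ^ l) ∣ p ^ a := by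
        rw [orderOf_dvd_iff_pow_eq_one, ← pow_mul, ← orderOf_dvd_iff_pow_eq_one, hN, mul_comm l]
        exact Nat.mul_dvd_mul_left _ ((Nat.modEq_zero_iff_dvd).1 hl0)
      obtain ⟨j, -, hj⟩ := (Nat.dvd_prime_pow hp).1 this
      exact ⟨j, hj⟩
    · have : orderOf (g ^ k) ∣ m := by
        rw [orderOf_dvd_iff_pow_eq_one, ← pow_mul, ← orderOf_dvd_iff_pow_eq_one, hN]
        exact Nat.mul_dvd_mul_right ((Nat.modEq_zero_iff_dvd).1 hk0) _
      exact fun h => hm (h.trans this)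
  · exact ⟨g, 1, by simp, Commute.one_left g, ⟨0, by simp⟩, by simpa using hpos.ne'⟩

end CoprimePart

/-! ### Simple characters as numbers of fixed faces -/

section FaceTrace

variable (F : Type u) [Field F] {n : ℕ}

open Classical in
/-- The sum of the coefficients of the faces fixed by a permutation. -/
noncomputable def faceTrace (π : Perm (Fin n)) :
    MonoidAlgebra F (Face (Fin n)) →ₗ[F] F where
  toFun a := ∑ G with π ∈ G.stabilizer, a.coeff G
  map_add' a b := by simp [Finset.sum_add_distrib]
  map_smul' c a := by simp [Finset.mul_sum]

open Classical in
theorem faceTrace_apply (π : Perm (Fin n)) (a : MonoidAlgebra F (Face (Fin n))) :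
    faceTrace F π a = ∑ G with π ∈ G.stabilizer, a.coeff G := rfl

theorem faceTrace_toFaces_xi (π : Perm (Fin n)) (q : Composition n) :
    faceTrace F π (toFaces F (xi F q)) =
      Nat.card {G : Face (Fin n) // G.type = q ∧ π ∈ G.stabilizer} := by
  classical
  rw [faceTrace_apply]
  simp only [toFaces_coeff, ← xiBasis_apply, Module.Basis.repr_self, Finsupp.single_apply]
  rw [Finset.sum_boole, Nat.card_eq_fintype_card, Fintype.card_subtype, Finset.filter_filter]
  congr 2
  ext G
  simp [and_comm, eq_comm]

theorem simpleCharacter_eq_faceTrace (μ : n.Partition) (x : descentAlgebra F n) :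
    simpleCharacter F μ x = faceTrace F (permOfPartition μ) (toFaces F x) := by
  have : (simpleCharacter F μ).toLinearMap =
      faceTrace F (permOfPartition μ) ∘ₗ (toFaces F).toLinearMap := by
    refine (xiBasis F n).ext fun q => ?_
    simp only [xiBasis_apply, AlgHom.toLinearMap_apply, LinearMap.comp_apply]
    rw [faceTrace_toFaces_xi, simpleCharacter_xi, ← Face.card_fixedWord]
    exact congrArg Nat.cast (fixedCosets_eq q _)
  exact LinearMap.congr_fun this x

theorem faceTrace_eq_of_isConj {π σ : Perm (Fin n)} (h : IsConj π σ) (x : descentAlgebra F n) :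
    faceTrace F π (toFaces F x) = faceTrace F σ (toFaces F x) := by
  classical
  obtain ⟨ρ, rfl⟩ := isConj_iff.1 h
  rw [faceTrace_apply, faceTrace_apply]
  refine Finset.sum_equiv (Face.perm ρ⁻¹).toEquiv (fun G => ?_) (fun G _ => ?_)
  · simp only [Finset.mem_filter, Finset.mem_univ, true_and, Face.mem_stabilizer,
      MulEquiv.toEquiv_eq_coe, MulEquiv.coe_toEquiv, Face.perm_perm]
    rw [mul_assoc, inv_mul_cancel_left, ← Face.perm_perm]
    exact ((Face.perm ρ⁻¹).apply_eq_iff_eq).symm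
  · rw [toFaces_coeff, toFaces_coeff]
    exact congrArg _ (Face.type_perm _ G).symm

theorem simpleCharacter_eq_of_parts_eq {μ : n.Partition} {π : Perm (Fin n)}
    (h : π.partition.parts = μ.parts) (x : descentAlgebra F n) :
    simpleCharacter F μ x = faceTrace F π (toFaces F x) := by
  rw [simpleCharacter_eq_faceTrace]
  refine faceTrace_eq_of_isConj F (Perm.partition_eq_of_isConj.2 ?_) x
  exact Nat.Partition.ext ((exists_perm_parts μ).choose_spec.trans h.symm)

/-- Modulo `p`, the number of fixed faces of a given type only depends on the `p'`-part. -/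
theorem faceTrace_eq_of_isPrimeToPart {p : ℕ} [CharP F p] {σ τ : Perm (Fin n)}
    (h : IsPrimeToPart p σ τ) (x : descentAlgebra F n) :
    faceTrace F σ (toFaces F x) = faceTrace F τ (toFaces F x) := by
  classical
  have hp : p.Prime ∨ p = 0 := CharP.char_is_prime_or_zero F p
  obtain ⟨u, rfl, hc, hu, hτ⟩ := h
  have hco := coprime_of_primeTo hp hu hτ
  suffices H : faceTrace F (u * τ) ∘ₗ (toFaces F).toLinearMap =
      faceTrace F τ ∘ₗ (toFaces F).toLinearMap from LinearMap.congr_fun H x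
  refine (xiBasis F n).ext fun q => ?_
  simp only [xiBasis_apply, AlgHom.toLinearMap_apply, LinearMap.comp_apply, faceTrace_toFaces_xi]
  rw [CharP.cast_eq_iff_mod_eq F p]
  obtain ⟨k, hk⟩ := hu
  rcases hp with hp | rfl
  · have : Fact p.Prime := ⟨hp⟩
    -- The p-element u acts on the faces fixed by τ, since it commutes with τ. Its fixed points
    -- there are the faces fixed by u * τ, so the two counts agree modulo p.
    let f : Function.End {G : Face (Fin n) // G.type = q ∧ τ ∈ G.stabilizer} := fun G =>
      ⟨Face.perm u G.1, (Face.type_perm _ _).trans G.2.1, by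
        rw [Face.mem_stabilizer, Face.perm_perm, hc.eq, ← Face.perm_perm, G.2.2]⟩
    have hf : ∀ j G, ((f ^ j) G).1 = Face.perm (u ^ j) G.1 := by
      intro j
      induction j with
      | zero => intro G; rfl
      | succ j ih =>
        intro G
        rw [pow_succ', pow_succ, ← Face.perm_perm, ← ih]
        rfl
    have hf1 : f ^ p ^ k = 1 := by
      funext G
      refine Subtype.ext ?_
      rw [hf, ← hk, pow_orderOf_eq_one]
      rfl
    have := Perm.card_fixedPoints_modEq hf1
    rw [Nat.card_eq_fintype_card (α := {G : Face (Fin n) // G.type = q ∧ τ ∈ G.stabilizer})]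
    refine Eq.trans ?_ this.symm
    rw [← Nat.card_eq_fintype_card]
    congr 1
    refine Nat.card_congr
      { toFun := fun G => ⟨⟨G.1, G.2.1, ((mul_mem_iff_of_coprime hc hco _).1 G.2.2).2⟩,
          Subtype.ext ((mul_mem_iff_of_coprime hc hco _).1 G.2.2).1⟩
        invFun := fun G => ⟨G.1.1, G.1.2.1, (mul_mem_iff_of_coprime hc hco _).2
          ⟨congrArg Subtype.val G.2, G.1.2.2⟩⟩
        left_inv := fun _ => rfl
        right_inv := fun _ => rfl }
  -- In characteristic zero the order of u is 0 ^ k and positive, which forces u = 1.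
  · have := orderOf_pos u
    rcases k with - | k
    · rw [pow_zero, orderOf_eq_one_iff] at hk
      rw [hk, one_mul]
    · simp [hk] at this

theorem simpleCharacter_eq_of_pEquivalent {p : ℕ} [CharP F p] {μ ν : n.Partition}
    (h : PEquivalent p μ ν) : simpleCharacter F μ = simpleCharacter F ν := by
  have hp : p.Prime ∨ p = 0 := CharP.char_is_prime_or_zero F p
  obtain ⟨σ, hσ⟩ := exists_perm_parts μ
  obtain ⟨τ, hτ⟩ := exists_perm_parts ν
  obtain ⟨σ', hσ'⟩ := exists_isPrimeToPart hp σ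
  obtain ⟨τ', hτ'⟩ := exists_isPrimeToPart hp τ
  ext x
  rw [simpleCharacter_eq_of_parts_eq F hσ, simpleCharacter_eq_of_parts_eq F hτ,
    faceTrace_eq_of_isPrimeToPart F hσ', faceTrace_eq_of_isPrimeToPart F hτ',
    faceTrace_eq_of_isConj F (h σ τ hσ hτ σ' τ' hσ' hτ')]

/-- Group the faces fixed by π and the s-cycle by their restrictions; by
`Face.mem_stabilizer_sumPerm` they are exactly the joining faces over the faces fixed by π. -/
theorem faceTrace_descentRestrict {m s : ℕ} (π : Perm (Fin m)) (x : descentAlgebra F (m + s)) :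
    faceTrace F π (toFaces F (descentRestrict F x)) =
      faceTrace F (sumPerm π (finRotate s)) (toFaces F x) := by
  classical
  rw [faceTrace_apply, faceTrace_apply, toFaces_descentRestrict]
  simp only [restrictFaces_coeff, Face.mem_stabilizer_sumPerm]
  rw [← Finset.sum_fiberwise_of_maps_to (t := Finset.univ.filter fun H => π ∈ H.stabilizer)
    (g := Face.comap (Fin.castAdd s)) (fun G hG => by simpa using (Finset.mem_filter.1 hG).2.2)]
  refine Finset.sum_congr rfl fun H hH => ?_
  rw [Finset.filter_filter]
  refine Finset.sum_congr (Finset.filter_congr fun G _ => ?_) fun _ _ => rfl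
  refine ⟨fun h => ⟨⟨h.1, ?_⟩, h.2⟩, fun h => ⟨h.1.1, h.2⟩⟩
  rw [h.2]
  exact (Finset.mem_filter.1 hH).2

end FaceTrace

/-! ### Cycle types through periods of points -/

theorem minimalPeriod_eq_card_support_cycleOf {α : Type*} [Fintype α] [DecidableEq α]
    {σ : Perm α} {x : α} (hx : x ∈ σ.support) :
    Function.minimalPeriod σ x = (σ.cycleOf x).support.card := by
  have hc := σ.isCycle_cycleOf (Perm.mem_support.1 hx)
  have hx' : (σ.cycleOf x) x ≠ x := by simpa using Perm.mem_support.1 hx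
  have : ∀ k, Function.minimalPeriod σ x ∣ k ↔ (σ.cycleOf x).support.card ∣ k := by
    intro k
    rw [← hc.orderOf, orderOf_dvd_iff_pow_eq_one, ← Function.isPeriodicPt_iff_minimalPeriod_dvd,
      hc.pow_eq_one_iff' hx', Perm.cycleOf_pow_apply_self, Function.IsPeriodicPt,
      Function.IsFixedPt, Perm.iterate_eq_pow]
  exact Nat.dvd_antisymm ((this _).2 dvd_rfl) ((this _).1 dvd_rfl)

/-- A cycle of length k consists of k points of period k. Nontrivial cycles and fixed points are
treated separately, as in the definition of `Perm.partition`. -/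
theorem card_filter_minimalPeriod {α : Type*} [Fintype α] [DecidableEq α] (σ : Perm α)
    (P : ℕ → Prop) [DecidablePred P] :
    (Finset.univ.filter fun x => P (Function.minimalPeriod σ x)).card =
      (σ.partition.parts.filter P).sum := by
  have hsplit := Finset.card_filter_add_card_filter_not (s := Finset.univ.filter fun x =>
    P (Function.minimalPeriod σ x)) (fun x => x ∈ σ.support)
  rw [← hsplit, Perm.parts_partition, Multiset.filter_add, Multiset.sum_add]
  congr 1
  · rw [Perm.cycleType_def, Multiset.filter_map, ← Finset.filter_val, Finset.sum_map_val,
      Finset.sum_filter,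
      Finset.card_eq_sum_card_fiberwise (f := σ.cycleOf) (t := σ.cycleFactorsFinset)]
    · refine Finset.sum_congr rfl fun c hc => ?_
      have hmem : ∀ x, x ∈ σ.support ∧ σ.cycleOf x = c ↔ x ∈ c.support := by
        intro x
        constructor
        · rintro ⟨hx, rfl⟩
          simpa [Perm.mem_support_cycleOf_iff] using hx
        · intro hx
          exact ⟨Perm.mem_cycleFactorsFinset_support_le hc hx,
            (Perm.cycle_is_cycleOf hx hc).symm⟩
      have : ((Finset.univ.filter fun x => P (Function.minimalPeriod σ x)).filter
          (fun x => x ∈ σ.support)).filter (fun x => σ.cycleOf x = c) =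
          if P c.support.card then c.support else ∅ := by
        ext x
        simp only [Finset.mem_filter, Finset.mem_univ, true_and]
        have h : P (Function.minimalPeriod σ x) ∧ x ∈ σ.support ∧ σ.cycleOf x = c ↔
            P c.support.card ∧ x ∈ c.support := by
          rw [hmem]
          refine and_congr_left fun hx => ?_
          obtain ⟨h1, h2⟩ := (hmem x).2 hx
          rw [minimalPeriod_eq_card_support_cycleOf h1, h2]
        rw [and_assoc, h]
        split_ifs with hP <;> simp [hP]
      rw [this]
      simp only [Function.comp_apply]
      split_ifs <;> simp
    · intro x hx
      simp only [Finset.coe_filter, Set.mem_ofPred_eq] at hx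
      exact Perm.cycleOf_mem_cycleFactorsFinset_iff.2 hx.2
  · have h1 : ∀ x, x ∉ σ.support → Function.minimalPeriod σ x = 1 := by
      intro x hx
      rw [Perm.notMem_support] at hx
      exact Function.minimalPeriod_eq_one_iff_isFixedPt.2 hx
    have h2 : ((Finset.univ.filter fun x => P (Function.minimalPeriod σ x)).filter
        (fun x => x ∉ σ.support)) = if P 1 then σ.supportᶜ else ∅ := by
      ext x
      by_cases hx : x ∈ σ.support
      · split_ifs <;> simp_all
      · split_ifs with hP <;> simp [h1 x hx, hP]
    rw [h2]
    split_ifs with h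
    · rw [Multiset.filter_eq_self.2 fun a ha => (Multiset.eq_of_mem_replicate ha) ▸ h]
      simp [Finset.card_compl]
    · rw [Multiset.filter_eq_nil.2 fun a ha => (Multiset.eq_of_mem_replicate ha) ▸ h]
      simp

theorem sum_filter_eq_count_mul (M : Multiset ℕ) (d : ℕ) :
    (M.filter (· = d)).sum = M.count d * d := by
  simp [Multiset.filter_eq', Multiset.sum_replicate]

theorem count_mul_eq_card {n : ℕ} (σ : Perm (Fin n)) (d : ℕ) :
    σ.partition.parts.count d * d =
      (Finset.univ.filter fun x => Function.minimalPeriod σ x = d).card := by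
  rw [card_filter_minimalPeriod σ (· = d), sum_filter_eq_count_mul]

theorem eq_of_count_mul_eq {M N : Multiset ℕ} (hM : 0 ∉ M) (hN : 0 ∉ N)
    (h : ∀ d, M.count d * d = N.count d * d) : M = N := by
  ext d
  rcases Nat.eq_zero_or_pos d with rfl | hd
  · rw [Multiset.count_eq_zero.2 hM, Multiset.count_eq_zero.2 hN]
  · exact Nat.eq_of_mul_eq_mul_right hd (h d)

theorem zero_notMem_parts {n : ℕ} (μ : n.Partition) : 0 ∉ μ.parts := fun h =>
  (μ.parts_pos h).ne rfl

theorem addPart_parts {n : ℕ} (μ : n.Partition) {s : ℕ} (hs : 1 ≤ s) :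
    (addPart μ s).parts = s ::ₘ μ.parts := by
  refine Multiset.filter_eq_self.2 fun a ha => ?_
  rcases Multiset.mem_cons.1 ha with rfl | ha
  · omega
  · exact (μ.parts_pos ha).ne'

theorem parts_finRotate {s : ℕ} (hs : 1 ≤ s) : (finRotate s).partition.parts = {s} := by
  obtain ⟨k, rfl⟩ : ∃ k, s = k + 1 := ⟨s - 1, by omega⟩
  rw [Perm.parts_partition]
  rcases k with - | k
  · have : finRotate (0 + 1) = 1 := by
      ext i
      simp
    rw [this]
    simp
  · rw [cycleType_finRotate, support_finRotate]
    simp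

theorem minimalPeriod_eq_of_semiconj {α β : Type*} {f : α → α} {g : β → β} {j : α → β}
    (hj : Function.Injective j) (h : ∀ a, g (j a) = j (f a)) (a : α) :
    Function.minimalPeriod g (j a) = Function.minimalPeriod f a := by
  have hit : ∀ k, g^[k] (j a) = j (f^[k] a) := fun k =>
    ((Function.Semiconj.iterate_right (f := j) (fun a => (h a).symm) k) a).symm
  have : ∀ k, Function.minimalPeriod g (j a) ∣ k ↔ Function.minimalPeriod f a ∣ k := by
    intro k
    rw [← Function.isPeriodicPt_iff_minimalPeriod_dvd,
      ← Function.isPeriodicPt_iff_minimalPeriod_dvd]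
    exact (Eq.congr_left (hit k)).trans hj.eq_iff
  exact Nat.dvd_antisymm ((this _).2 dvd_rfl) ((this _).1 dvd_rfl)

theorem parts_sumPerm {m s : ℕ} (π : Perm (Fin m)) (τ : Perm (Fin s)) :
    (sumPerm π τ).partition.parts = π.partition.parts + τ.partition.parts := by
  refine eq_of_count_mul_eq (zero_notMem_parts _) ?_ fun d => ?_
  · rw [Multiset.mem_add, not_or]
    exact ⟨zero_notMem_parts _, zero_notMem_parts _⟩
  · rw [Multiset.count_add, add_mul, count_mul_eq_card, count_mul_eq_card, count_mul_eq_card,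
      card_filter_add]
    congr 3
    · ext i
      rw [minimalPeriod_eq_of_semiconj (Fin.castAdd_injective m s) (sumPerm_castAdd π τ)]
    · ext i
      rw [minimalPeriod_eq_of_semiconj (Fin.natAdd_injective s m) (sumPerm_natAdd π τ)]

/-- Simple characters pull back to simple characters along `descentRestrict`. -/
theorem simpleCharacter_addPart {F : Type*} [Field F] {m s : ℕ} (hs : 1 ≤ s) (μ : m.Partition) :
    simpleCharacter F (addPart μ s) = (simpleCharacter F μ).comp (descentRestrict F) := by
  obtain ⟨π, hπ⟩ := exists_perm_parts μ
  ext x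
  have : (sumPerm π (finRotate s)).partition.parts = (addPart μ s).parts := by
    rw [parts_sumPerm, hπ, addPart_parts μ hs, parts_finRotate hs, add_comm]
    rfl
  rw [AlgHom.comp_apply, simpleCharacter_eq_of_parts_eq F this,
    simpleCharacter_eq_of_parts_eq F hπ, faceTrace_descentRestrict]

/-! ### p-equivalence and p-regular partitions -/

section Regular

variable {n : ℕ} {p : ℕ}

/-- The number of points in the cycles whose length has `p'`-part `d`. -/
def primeToWeight (p : ℕ) (μ : n.Partition) (d : ℕ) : ℕ :=
  (μ.parts.filter fun k => ordCompl[p] k = d).sum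

/-- Applied to the stabilizer of x, `mul_mem_iff_of_coprime` shows that the period of x under u * τ
is the product of its periods under u, a power of p, and under τ, which is prime to p. For p = 0, u
= 1 and `ordCompl[0]` is the identity. -/
theorem minimalPeriod_of_isPrimeToPart (hp : p.Prime ∨ p = 0) {σ τ : Perm (Fin n)}
    (h : IsPrimeToPart p σ τ) (x : Fin n) :
    Function.minimalPeriod τ x = ordCompl[p] (Function.minimalPeriod σ x) := by
  obtain ⟨u, rfl, hc, hu, hτ⟩ := h
  have hco := coprime_of_primeTo hp hu hτ
  have hdvd : ∀ (π : Perm (Fin n)) k, Function.minimalPeriod π x ∣ k ↔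
      π ^ k ∈ MulAction.stabilizer (Perm (Fin n)) x := by
    intro π k
    rw [← Function.isPeriodicPt_iff_minimalPeriod_dvd, MulAction.mem_stabilizer_iff,
      Perm.smul_def, Function.IsPeriodicPt, Function.IsFixedPt, Perm.iterate_eq_pow]
  have hle : ∀ π : Perm (Fin n), Function.minimalPeriod π x ∣ orderOf π := by
    intro π
    rw [hdvd, pow_orderOf_eq_one]
    exact one_mem _
  have hco' := hco.coprime_dvd_left (hle u) |>.coprime_dvd_right (hle τ)
  have key : ∀ k, Function.minimalPeriod (u * τ : Perm (Fin n)) x ∣ k ↔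
      Function.minimalPeriod u x * Function.minimalPeriod τ x ∣ k := by
    intro k
    rw [hdvd, hc.mul_pow, mul_mem_iff_of_coprime (hc.pow_pow k k)
      (hco.coprime_dvd_left (orderOf_pow_dvd k) |>.coprime_dvd_right (orderOf_pow_dvd k)),
      ← hdvd, ← hdvd]
    exact ⟨fun h => hco'.mul_dvd_of_dvd_of_dvd h.1 h.2,
      fun h => ⟨dvd_of_mul_right_dvd h, dvd_of_mul_left_dvd h⟩⟩
  rw [Nat.dvd_antisymm ((key _).2 dvd_rfl) ((key _).1 dvd_rfl)]
  have hτp : ¬ p ∣ Function.minimalPeriod τ x := fun h => hτ (h.trans (hle τ))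
  obtain ⟨k, hk⟩ := hu
  rcases hp with hp | rfl
  · obtain ⟨j, -, hj⟩ := (Nat.dvd_prime_pow hp).1 (hk ▸ hle u)
    rw [hj, Nat.ordCompl_mul, Nat.factorization_eq_zero_of_not_dvd hτp]
    simp [hp.factorization_pow, hp.pos]
  · have hpos := orderOf_pos u
    have hu1 : orderOf u = 1 := by
      rcases k with - | k
      · simpa using hk
      · simp [hk] at hpos
    have := Nat.dvd_one.1 (hu1 ▸ hle u)
    simp [this]

theorem isConj_iff_minimalPeriod {σ τ : Perm (Fin n)} :
    IsConj σ τ ↔ ∀ d, (Finset.univ.filter fun x => Function.minimalPeriod σ x = d).card =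
      (Finset.univ.filter fun x => Function.minimalPeriod τ x = d).card := by
  rw [Perm.partition_eq_of_isConj]
  constructor
  · intro h d
    rw [← count_mul_eq_card, ← count_mul_eq_card, h]
  · intro h
    refine Nat.Partition.ext (eq_of_count_mul_eq (zero_notMem_parts _) (zero_notMem_parts _) ?_)
    intro d
    rw [count_mul_eq_card, count_mul_eq_card, h]

theorem isConj_primeToPart_iff (hp : p.Prime ∨ p = 0) {μ ν : n.Partition}
    {σ τ σ' τ' : Perm (Fin n)} (hσ : σ.partition.parts = μ.parts)
    (hτ : τ.partition.parts = ν.parts) (hσ' : IsPrimeToPart p σ σ') (hτ' : IsPrimeToPart p τ τ') :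
    IsConj σ' τ' ↔ ∀ d, primeToWeight p μ d = primeToWeight p ν d := by
  rw [isConj_iff_minimalPeriod]
  simp only [minimalPeriod_of_isPrimeToPart hp hσ', minimalPeriod_of_isPrimeToPart hp hτ']
  refine forall_congr' fun d => ?_
  rw [card_filter_minimalPeriod σ fun k => ordCompl[p] k = d,
    card_filter_minimalPeriod τ fun k => ordCompl[p] k = d, hσ, hτ]
  rfl

/-- The definition quantifies over all permutations and p'-parts; since these exist and the weights
ignore the choice, one choice decides. -/
theorem pEquivalent_iff (hp : p.Prime ∨ p = 0) {μ ν : n.Partition} :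
    PEquivalent p μ ν ↔ ∀ d, primeToWeight p μ d = primeToWeight p ν d := by
  refine ⟨fun h => ?_, fun h σ τ hσ hτ σ' τ' hσ' hτ' =>
    (isConj_primeToPart_iff hp hσ hτ hσ' hτ').2 h⟩
  obtain ⟨σ, hσ⟩ := exists_perm_parts μ
  obtain ⟨τ, hτ⟩ := exists_perm_parts ν
  obtain ⟨σ', hσ'⟩ := exists_isPrimeToPart hp σ
  obtain ⟨τ', hτ'⟩ := exists_isPrimeToPart hp τ
  exact (isConj_primeToPart_iff hp hσ hτ hσ' hτ').1 (h σ τ hσ hτ σ' τ' hσ' hτ')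

theorem primeToWeight_addPart (μ : n.Partition) {s : ℕ} (hs : 1 ≤ s) (d : ℕ) :
    primeToWeight p (addPart μ s) d =
      (if ordCompl[p] s = d then s else 0) + primeToWeight p μ d := by
  rw [primeToWeight, addPart_parts μ hs, Multiset.filter_cons, Multiset.sum_add, primeToWeight]
  split_ifs <;> simp

/-- Every `p`-equivalence class contains a `p`-regular partition. -/
theorem exists_isRegular (hp : p.Prime ∨ p = 0) (μ : n.Partition) :
    ∃ ν : n.Partition, IsRegular p ν ∧ ∀ d, primeToWeight p ν d = primeToWeight p μ d := by
  rcases hp with hp | rfl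
  swap
  · exact ⟨μ, fun h => absurd rfl h, fun _ => rfl⟩
  induction hN : μ.parts.card using Nat.strong_induction_on generalizing μ with
  | _ N ih =>
  subst hN
  by_cases hreg : IsRegular p μ
  · exact ⟨μ, hreg, fun _ => rfl⟩
  obtain ⟨k, hk⟩ : ∃ k, p ≤ μ.parts.count k := by
    by_contra! h
    exact hreg fun _ => h
  obtain ⟨t, ht⟩ := Multiset.le_iff_exists_add.1 (Multiset.le_count_iff_replicate_le.1 hk)
  have hkpos : 0 < k := μ.parts_pos (Multiset.count_pos.1 (hp.pos.trans_le hk))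
  -- Merging p copies of k into one part p * k keeps the p'-part of the part size and the number of
  -- points, and lowers the number of parts.
  let ν : n.Partition :=
    { parts := (p * k) ::ₘ t
      parts_pos := by
        intro i hi
        rcases Multiset.mem_cons.1 hi with rfl | hi
        · exact Nat.mul_pos hp.pos hkpos
        · exact μ.parts_pos (ht ▸ Multiset.mem_add.2 (Or.inr hi))
      parts_sum := by
        rw [← μ.parts_sum, ht]
        simp }
  obtain ⟨ξ, h1, h2⟩ := ih ν.parts.card (by
    have := hp.two_le
    change (_ ::ₘ t).card < _
    rw [ht, Multiset.card_cons, Multiset.card_add, Multiset.card_replicate]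
    omega) ν rfl
  refine ⟨ξ, h1, fun d => (h2 d).trans ?_⟩
  have hord : ordCompl[p] (p * k) = ordCompl[p] k := by
    rw [Nat.ordCompl_mul]
    simp [hp.factorization_self, hp.pos]
  rw [primeToWeight, primeToWeight, ht, Multiset.filter_add, Multiset.filter_cons, hord,
    Multiset.sum_add, Multiset.sum_add]
  congr 1
  split_ifs with h
  · rw [Multiset.filter_eq_self.2 fun a ha => (Multiset.eq_of_mem_replicate ha) ▸ h]
    simp
  · rw [Multiset.filter_eq_nil.2 fun a ha => (Multiset.eq_of_mem_replicate ha) ▸ h]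

theorem primeToWeight_eq_sum (μ : n.Partition) (d : ℕ) :
    primeToWeight p μ d =
      ∑ k ∈ (Finset.range (n + 1)).filter (fun k => ordCompl[p] k = d), μ.parts.count k * k := by
  rw [primeToWeight, Finset.sum_multiset_count_of_subset _
    ((Finset.range (n + 1)).filter (fun k => ordCompl[p] k = d))]
  · refine Finset.sum_congr rfl fun k hk => ?_
    rw [Multiset.count_filter_of_pos (p := fun k => ordCompl[p] k = d) (Finset.mem_filter.1 hk).2,
      smul_eq_mul]
  · intro k hk
    obtain ⟨h1, h2⟩ := Multiset.mem_filter.1 (Multiset.mem_toFinset.1 hk)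
    refine Finset.mem_filter.2 ⟨Finset.mem_range.2 ?_, h2⟩
    have := Multiset.le_sum_of_mem h1
    rw [μ.parts_sum] at this
    omega

/-- A `p`-regular partition is determined by its `p`-equivalence class. -/
theorem eq_of_primeToWeight_eq (hp : p.Prime ∨ p = 0) {μ ν : n.Partition} (hμ : IsRegular p μ)
    (hν : IsRegular p ν) (h : ∀ d, primeToWeight p μ d = primeToWeight p ν d) : μ = ν := by
  refine Nat.Partition.ext (eq_of_count_mul_eq (zero_notMem_parts _) (zero_notMem_parts _) ?_)
  rcases hp with hp | rfl
  swap
  · intro d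
    simpa [primeToWeight, sum_filter_eq_count_mul] using h d
  intro e
  congr 1
  induction e using Nat.strong_induction_on with
  | _ e ih =>
  rcases Nat.eq_zero_or_pos e with rfl | he
  · rw [Multiset.count_eq_zero.2 (zero_notMem_parts _),
      Multiset.count_eq_zero.2 (zero_notMem_parts _)]
  have hbig : ∀ (ξ : n.Partition) k, n < k → ξ.parts.count k = 0 := by
    intro ξ k hk
    refine Multiset.count_eq_zero.2 fun hmem => ?_
    have := Multiset.le_sum_of_mem hmem
    rw [ξ.parts_sum] at this
    omega
  rcases lt_or_ge n e with hne | hne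
  · rw [hbig _ _ hne, hbig _ _ hne]
  set S := (Finset.range (n + 1)).filter fun k => ordCompl[p] k = ordCompl[p] e with hS
  have heS : e ∈ S := by simp [hS]; omega
  have h0 : ∑ k ∈ S, ((μ.parts.count k : ℤ) - ν.parts.count k) * k = 0 := by
    have := congrArg (Nat.cast (R := ℤ)) (h (ordCompl[p] e))
    rw [primeToWeight_eq_sum, primeToWeight_eq_sum] at this
    push_cast at this
    simp only [sub_mul, Finset.sum_sub_distrib]
    exact sub_eq_zero.2 this
  rw [← Finset.add_sum_erase S _ heS] at h0
  -- The part sizes with the same p'-part as e differ from e by powers of p: smaller ones cancel by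
  -- induction, larger ones are multiples of p * e. So p divides the difference of the
  -- multiplicities of e, and regularity bounds it by p in absolute value.
  have hdvd : ((p * e : ℕ) : ℤ) ∣
      ∑ k ∈ S.erase e, ((μ.parts.count k : ℤ) - ν.parts.count k) * k := by
    refine Finset.dvd_sum fun k hk => ?_
    obtain ⟨hke, hkS⟩ := Finset.mem_erase.1 hk
    rcases lt_or_gt_of_ne hke with hlt | hgt
    · rw [ih k hlt, sub_self, zero_mul]
      exact dvd_zero _
    · refine Dvd.dvd.mul_left (Int.natCast_dvd_natCast.2 ?_) _
      have hk : ordCompl[p] k = ordCompl[p] e := (Finset.mem_filter.1 hkS).2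
      have e1 := Nat.ordProj_mul_ordCompl_eq_self k p
      have e2 := Nat.ordProj_mul_ordCompl_eq_self e p
      rw [hk] at e1
      have hpow : e.factorization p < k.factorization p := by
        by_contra! hle
        have := Nat.mul_le_mul_right (ordCompl[p] e) (Nat.pow_le_pow_right hp.pos hle)
        omega
      rw [← e1]
      conv_lhs => rw [← e2]
      rw [← mul_assoc, ← pow_succ']
      exact Nat.mul_dvd_mul_right (pow_dvd_pow p hpow) _
  have h1 : ((p * e : ℕ) : ℤ) ∣ ((μ.parts.count e : ℤ) - ν.parts.count e) * e := by
    rw [eq_neg_of_add_eq_zero_left h0]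
    exact hdvd.neg_right
  push_cast at h1
  have h2 := Int.dvd_of_mul_dvd_mul_right (by exact_mod_cast he.ne') h1
  have h3 := hμ hp.ne_zero e
  have h4 := hν hp.ne_zero e
  have h5 := Int.eq_zero_of_abs_lt_dvd h2 (by rw [abs_lt]; omega)
  omega

end Regular

end Descent

/-! ### The embedding of quivers -/

theorem theorem4p7 {F : Type*} [Field F] (p : ℕ) [CharP F p] (m s : ℕ) (hs : 1 ≤ s) :
    ∃ φ : Descent.ExtQuiver F p m ⥤q Descent.ExtQuiver F p (m + s),
      Function.Injective φ.obj ∧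
      (∀ lam mu : Descent.ExtQuiver F p m,
        Function.Injective (φ.map : (lam ⟶ mu) → (φ.obj lam ⟶ φ.obj mu))) ∧
      ∀ (mu : Descent.ExtQuiver F p m) (lam : Descent.ExtQuiver F p (m + s)),
        Descent.PEquivalent p lam.1 (Descent.addPart mu.1 s) ↔ lam = φ.obj mu := by
  have hp : p.Prime ∨ p = 0 := CharP.char_is_prime_or_zero F p
  choose f hreg hf using fun mu : m.Partition =>
    Descent.exists_isRegular hp (Descent.addPart mu s)
  have hchar : ∀ mu, Descent.simpleCharacter F (f mu) =
      (Descent.simpleCharacter F mu).comp (Descent.descentRestrict F) := fun mu => by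
    rw [← Descent.simpleCharacter_addPart hs]
    exact Descent.simpleCharacter_eq_of_pEquivalent F ((Descent.pEquivalent_iff hp).2 (hf mu))
  have hle : ∀ lam mu, Descent.numArrows F lam mu ≤ Descent.numArrows F (f lam) (f mu) :=
    fun lam mu => Descent.numArrows_le (Descent.descentRestrict_surjective F hs)
      (hchar lam) (hchar mu)
  -- Arrows are only numbered, so the inequality of dimensions already provides an injection on
  -- them.
  refine ⟨⟨fun mu => ⟨f mu.1, hreg mu.1⟩, fun {lam mu} a => Fin.castLE (hle lam.1 mu.1) a⟩,
    ?_, fun lam mu => Fin.castLE_injective (hle lam.1 mu.1), fun mu lam => ?_⟩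
  · intro lam mu h
    have h := congrArg Subtype.val h
    refine Subtype.ext (Descent.eq_of_primeToWeight_eq hp lam.2 mu.2 fun d => ?_)
    have h1 := hf lam.1 d
    have h2 := hf mu.1 d
    simp only at h
    rw [h, h2, Descent.primeToWeight_addPart _ hs, Descent.primeToWeight_addPart _ hs] at h1
    omega
  · rw [Descent.pEquivalent_iff hp]
    constructor
    · intro h
      exact Subtype.ext (Descent.eq_of_primeToWeight_eq hp lam.2 (hreg _) fun d =>
        (h d).trans (hf _ d).symm)
    · rintro rfl
      exact hf _
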